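/- For an integer $n\ge 1$ let $\tau(n)=\sum_{d\mid n}1$ be the number of positive divisors of $n$. There is an absolute constant $c_0>0$ such that the quantity $\sum_{n\le x}\tau(n)$ can be computed deterministically in time $O(x^{1/2-c_0+o(1)})$. That is, there are a constant $c_0>0$, a single deterministic (multi-tape) Turing machine, a function $T:\mathbb N\to\mathbb N$ and a function $\varepsilon:\mathbb N\to\mathbb R$ with $\varepsilon(x)\to 0$ as $x\to\infty$, such that $T(x)=O\big(x^{1/2-c_0+\varepsilon(x)}\big)$ as $x\to\infty$ and such that, for every integer $x\ge 0$, the machine, given only the binary expansion of $x$ as input, halts with the binary expansion of $\sum_{1\le n\le x}\tau(n)$ as output after at most $T(x)$ steps and using at most $T(x)$ units of memory. -/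

import Mathlib

open Asymptotics

/-- The deterministic machine `tm`, whose input and output alphabets are identified with the binary
digits by `i` and `o`, turns the binary expansion of `a` into the binary expansion of `b` in at most
`t` steps, and at no moment of this run do its stacks hold more than `t` symbols altogether.

`Turing.FinTM2` is Mathlib's Turing machine with finitely many work stacks (a tape is a pair of
stacks), finitely many states, and a step that performs a bounded number of elementary
operations. -/
def OutputsWithin (tm : Turing.FinTM2) (i : tm.Γ tm.k₀ ≃ Bool) (o : tm.Γ tm.k₁ ≃ Bool)
    (a b t : ℕ) : Prop :=
  Nonempty (Turing.TM2OutputsInTime tm ((Computability.encodeNat a).map i.symm)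
      (some ((Computability.encodeNat b).map o.symm)) t) ∧
    ∀ c : tm.Cfg,
      StateTransition.Reaches tm.step
        (Turing.initList tm ((Computability.encodeNat a).map i.symm)) c →
      ∑ k ∈ @Finset.univ tm.K tm.kFin, (c.stk k).length ≤ t

/-- `f` can be computed deterministically in time at most `T`: a single Turing machine over finite
alphabets, taking only the integer `x` (in binary) as input, produces `f x` in at most `T x` steps
and using at most `T x` units of memory. -/
def ComputableInTimeAtMost (f T : ℕ → ℕ) : Prop :=
  ∃ (tm : Turing.FinTM2) (i : tm.Γ tm.k₀ ≃ Bool) (o : tm.Γ tm.k₁ ≃ Bool),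
    (∀ k, Finite (tm.Γ k)) ∧ ∀ x : ℕ, OutputsWithin tm i o x (f x) (T x)

/-- The summatory function `∑_{n ≤ x} τ(n)` of the number-of-divisors function. -/
def divisorSum (x : ℕ) : ℕ :=
  ∑ n ∈ Finset.Icc 1 x, n.divisors.card

/-!
By Dirichlet's hyperbola method (`divisorSum_add_sq`) the divisor sum is `2 * ∑_{d ≤ s} ⌊x / d⌋ - s
^ 2` with `s = ⌊√x⌋`. The sum over `d` is not evaluated term by term but in blocks of `L`
consecutive `d`, where `L` is about `x ^ (1 / 64)`. On a block, the tangent of `t ↦ x / t` at the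
right end and a parallel of it enclose `x / d`. The sum of the integral parts of a linear function
is found with a Euclidean algorithm in `O(log x)` arithmetic operations (`two_mul_floorSum_mod`,
`floorSum_reciprocity`). If these sums agree for the two linear bounds, then the contribution of
the whole block is known; otherwise the algorithm evaluates only the first term of the block and
goes on with the block that starts one later. Hence it takes at most `s / L` rounds plus one for
each bad block (`rounds`).

Bad blocks are rare. If the two bounds disagree on a block beyond `s / L`, an integer `m` lies
between them at some point `d` of the block, and then `d * m` differs from `x` by at most `L ^ 4`
(`exists_dvd_of_not_goodBlock`). So `d` is a divisor of one of the `2 * L ^ 4 + 1` numbers around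
`x`, each of which has only `O(x ^ (1 / 3))` divisors (`card_divisors_pow_three_le`). Altogether
there are `O(L ^ 31) = O(x ^ (31 / 64))` rounds (`rounds_add_le`), each of which costs a power of
`log x`; this gives the exponent `1 / 2 - 1 / 128`.

For the machine, the algorithm is written as a structured program (`Cmd`) for a fixed set of
registers whose width is proportional to the number of digits of `x`. The memory is a list of
columns that hold one bit of each register, so that a column is a single symbol of a finite
alphabet, and each instruction, such as an addition, is one pass of a finite transducer over the
columns (`Op.eval_registers`). A pass moves the columns from one stack to another and back, which
compiles programs to stack machines with a linear slowdown in the width (`Exec.within`,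
`exists_computableInTimeAtMost`). As a step puts a bounded number of symbols on the stacks, the
time bounds the space as well. The correctness of the program and the number of its instructions
are proved together, with assertions of the form `Computes`.
-/

namespace DivisorSummatory

/-! ### A word-level programming language -/

/-- A column of a memory of `V`-indexed binary registers: one bit of every register. -/
abbrev Column (V : Type) := V → Bool

/-- The elementary instructions on registers; all of them act modulo `2 ^ W`, where `W` is the
width of the memory, and use a flag for carries and for outcomes of comparisons. -/
inductive Op (V : Type)
  | add (u v : V)
  | sub (u v : V)
  | lt (u v : V)
  | copy (u v : V)

/-- Structured programs. The command `loop c d` runs `c` and leaves if the flag is then set, and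
otherwise runs `d` and starts again. -/
inductive Cmd (V : Type)
  | op (o : Op V)
  | flag (b : Bool)
  | seq (c d : Cmd V)
  | ite (c d : Cmd V)
  | loop (c d : Cmd V)

/-- An abstract memory state: the values of the registers, and the flag. -/
abbrev State (V : Type) := (V → ℕ) × Bool

section Semantics

variable {V : Type} [DecidableEq V]

/-- The effect of an instruction on registers of width `W`. The incoming flag is the incoming carry
of `add`, the incoming borrow of `sub`, and the outcome of `lt` on equal operands. -/
def Op.eval (W : ℕ) : Op V → State V → State V
  | .add u v, s => (Function.update s.1 u ((s.1 u + s.1 v + s.2.toNat) % 2 ^ W),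
      decide (2 ^ W ≤ s.1 u + s.1 v + s.2.toNat))
  | .sub u v, s => (Function.update s.1 u ((s.1 u + 2 ^ W - (s.1 v + s.2.toNat)) % 2 ^ W),
      decide (s.1 u < s.1 v + s.2.toNat))
  | .lt u v, s => (s.1, decide (s.1 u < s.1 v + s.2.toNat))
  | .copy u v, s => (Function.update s.1 u (s.1 v), s.2)

/-- `Exec W c t s s'`: the program `c`, run on registers of width `W` from the state `s`, ends in
the state `s'`, and `t` counts the instructions and tests that are carried out. -/
inductive Exec (W : ℕ) : Cmd V → ℕ → State V → State V → Prop
  | op (o : Op V) (s : State V) : Exec W (.op o) 1 s (o.eval W s)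
  | flag (b : Bool) (s : State V) : Exec W (.flag b) 1 s (s.1, b)
  | seq {c d : Cmd V} {t₁ t₂ : ℕ} {s s₁ s₂ : State V} :
      Exec W c t₁ s s₁ → Exec W d t₂ s₁ s₂ → Exec W (.seq c d) (t₁ + t₂) s s₂
  | ite_true {c d : Cmd V} {t : ℕ} {s s' : State V} :
      s.2 = true → Exec W c t s s' → Exec W (.ite c d) (1 + t) s s'
  | ite_false {c d : Cmd V} {t : ℕ} {s s' : State V} :
      s.2 = false → Exec W d t s s' → Exec W (.ite c d) (1 + t) s s'
  | loop_done {c d : Cmd V} {t : ℕ} {s s' : State V} :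
      Exec W c t s s' → s'.2 = true → Exec W (.loop c d) (t + 1) s s'
  | loop_again {c d : Cmd V} {t₁ t₂ t₃ : ℕ} {s s₁ s₂ s₃ : State V} :
      Exec W c t₁ s s₁ → s₁.2 = false → Exec W d t₂ s₁ s₂ → Exec W (.loop c d) t₃ s₂ s₃ →
      Exec W (.loop c d) (t₁ + 1 + (t₂ + t₃)) s s₃

end Semantics

/-! ### Instructions as passes of a finite transducer over the columns -/

section Columns

variable {V : Type}

/-- The number whose binary digits, lowest digit first, are the entries of the columns in row
`v`. -/
def rowValue (v : V) : List (Column V) → ℕ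
  | [] => 0
  | c :: l => (c v).toNat + 2 * rowValue v l

/-- The values of all registers stored in a list of columns, lowest digits first. -/
def registers (l : List (Column V)) : V → ℕ := fun v => rowValue v l

lemma rowValue_lt (v : V) (l : List (Column V)) : rowValue v l < 2 ^ l.length := by
  induction l with
  | nil => simp [rowValue]
  | cons c l ih =>
    have := Bool.toNat_lt (c v)
    simp only [rowValue, List.length_cons, pow_succ]
    omega

variable [DecidableEq V]

/-- The transducer that carries out an instruction: from the flag and a column it produces the next
flag and the new column. -/
def Op.digit : Op V → Bool → Column V → Bool × Column V
  | .add u v, f, c => ((c u && c v) || (f && (c u || c v)),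
      Function.update c u ((c u).xor ((c v).xor f)))
  | .sub u v, f, c => ((!c u && (c v || f)) || (c v && f),
      Function.update c u ((c u).xor ((c v).xor f)))
  | .lt u v, f, c => ((!c u && (c v || f)) || (c v && f), c)
  | .copy u v, f, c => (f, Function.update c u (c v))

/-- The run of the transducer of an instruction over a list of columns. -/
def Op.pass (o : Op V) : Bool → List (Column V) → Bool × List (Column V)
  | f, [] => (f, [])
  | f, c :: l => ((o.pass (o.digit f c).1 l).1, (o.digit f c).2 :: (o.pass (o.digit f c).1 l).2)

lemma Op.length_pass (o : Op V) (f : Bool) (l : List (Column V)) :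
    (o.pass f l).2.length = l.length := by
  induction l generalizing f with
  | nil => rfl
  | cons c l ih => simp [Op.pass, ih]

lemma rowValue_pass_add (u v : V) (f : Bool) (l : List (Column V)) :
    rowValue u ((Op.add u v).pass f l).2 + 2 ^ l.length * ((Op.add u v).pass f l).1.toNat =
      rowValue u l + rowValue v l + f.toNat := by
  induction l generalizing f with
  | nil => simp [Op.pass, rowValue]
  | cons c l ih =>
    have := ih ((Op.add u v).digit f c).1
    simp only [Op.pass, rowValue, List.length_cons, pow_succ]
    have h : (((Op.add u v).digit f c).2 u).toNat + 2 * ((Op.add u v).digit f c).1.toNat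
        = (c u).toNat + (c v).toNat + f.toNat := by
      cases hu : c u <;> cases hv : c v <;> cases f <;> simp [Op.digit, hu, hv]
    linarith

lemma rowValue_pass_sub (u v : V) (f : Bool) (l : List (Column V)) :
    rowValue u ((Op.sub u v).pass f l).2 + rowValue v l + f.toNat =
      rowValue u l + 2 ^ l.length * ((Op.sub u v).pass f l).1.toNat := by
  induction l generalizing f with
  | nil => simp [Op.pass, rowValue]
  | cons c l ih =>
    have := ih ((Op.sub u v).digit f c).1
    simp only [Op.pass, rowValue, List.length_cons, pow_succ]
    have h : (((Op.sub u v).digit f c).2 u).toNat + (c v).toNat + f.toNat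
        = (c u).toNat + 2 * ((Op.sub u v).digit f c).1.toNat := by
      cases hu : c u <;> cases hv : c v <;> cases f <;> simp [Op.digit, hu, hv]
    linarith

lemma pass_lt_fst (u v : V) (f : Bool) (l : List (Column V)) :
    ((Op.lt u v).pass f l).1 = ((Op.sub u v).pass f l).1 := by
  induction l generalizing f with
  | nil => rfl
  | cons c l ih => simpa [Op.pass, Op.digit] using ih _

lemma pass_lt_snd (u v : V) (f : Bool) (l : List (Column V)) :
    ((Op.lt u v).pass f l).2 = l := by
  induction l generalizing f with
  | nil => rfl
  | cons c l ih => simpa [Op.pass, Op.digit] using ih _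

lemma pass_copy_fst (u v : V) (f : Bool) (l : List (Column V)) :
    ((Op.copy u v).pass f l).1 = f := by
  induction l generalizing f with
  | nil => rfl
  | cons c l ih => simpa [Op.pass, Op.digit] using ih _

lemma rowValue_pass_copy (u v : V) (f : Bool) (l : List (Column V)) :
    rowValue u ((Op.copy u v).pass f l).2 = rowValue v l := by
  induction l generalizing f with
  | nil => rfl
  | cons c l ih => simp [Op.pass, Op.digit, rowValue, ih]

/-- The register that an instruction may change. -/
def Op.target : Op V → V
  | .add u _ | .sub u _ | .lt u _ | .copy u _ => u

lemma rowValue_pass_of_ne (o : Op V) {w : V} (hw : w ≠ o.target) (f : Bool)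
    (l : List (Column V)) : rowValue w (o.pass f l).2 = rowValue w l := by
  induction l generalizing f with
  | nil => rfl
  | cons c l ih =>
    have : (o.digit f c).2 w = c w := by
      cases o <;> simp_all [Op.digit, Op.target]
    simp [Op.pass, rowValue, ih, this]

lemma pass_sub_fst (u v : V) (f : Bool) (l : List (Column V)) :
    ((Op.sub u v).pass f l).1 = decide (rowValue u l < rowValue v l + f.toNat) := by
  have h := rowValue_pass_sub u v f l
  have h₁ := rowValue_lt u ((Op.sub u v).pass f l).2
  rw [Op.length_pass] at h₁
  cases hc : ((Op.sub u v).pass f l).1 <;> simp [hc] at h <;> symm <;> simp <;> omega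

/-- A pass of the transducer over the columns carries out the instruction on the registers. -/
lemma Op.eval_registers (o : Op V) (f : Bool) (l : List (Column V)) :
    o.eval l.length (registers l, f) = (registers (o.pass f l).2, (o.pass f l).1) := by
  have key : ∀ n : ℕ, n = rowValue o.target (o.pass f l).2 →
      Function.update (registers l) o.target n = registers (o.pass f l).2 := by
    intro n hn
    funext w
    by_cases hw : w = o.target
    · subst hw; simp [hn, registers]
    · simp [hw, registers, rowValue_pass_of_ne]
  have hlt := rowValue_lt o.target (o.pass f l).2
  rw [Op.length_pass] at hlt
  cases o with
  | add u v =>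
    have h := rowValue_pass_add u v f l
    simp only [Op.target] at key hlt
    refine Prod.ext (key _ ?_) ?_
    · change (rowValue u l + rowValue v l + f.toNat) % _ = _
      rw [← h, Nat.add_mul_mod_self_left, Nat.mod_eq_of_lt hlt]
    · have e : decide (2 ^ l.length ≤ rowValue u l + rowValue v l + f.toNat) =
          ((Op.add u v).pass f l).1 := by
        rw [← h]
        cases ((Op.add u v).pass f l).1 <;> simp [hlt]
      exact e
  | sub u v =>
    have h := rowValue_pass_sub u v f l
    simp only [Op.target] at key hlt
    refine Prod.ext (key _ ?_) (pass_sub_fst u v f l).symm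
    change (rowValue u l + 2 ^ l.length - (rowValue v l + f.toNat)) % _ = _
    cases hc : ((Op.sub u v).pass f l).1 <;> simp only [hc] at h <;> simp at h
    · rw [show rowValue u l + 2 ^ l.length - (rowValue v l + f.toNat)
        = rowValue u ((Op.sub u v).pass f l).2 + 2 ^ l.length by omega, Nat.add_mod_right,
        Nat.mod_eq_of_lt hlt]
    · rw [← h, show rowValue u ((Op.sub u v).pass f l).2 + rowValue v l + f.toNat
        - (rowValue v l + f.toNat) = rowValue u ((Op.sub u v).pass f l).2 by omega,
        Nat.mod_eq_of_lt hlt]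
  | lt u v =>
    refine Prod.ext ?_ ?_
    · simp only [Op.eval, pass_lt_snd]
    · rw [pass_lt_fst, pass_sub_fst]; rfl
  | copy u v =>
    refine Prod.ext (key _ ?_) (pass_copy_fst u v f l).symm
    exact (rowValue_pass_copy u v f l).symm

end Columns

/-! ### Timed runs of a transition function -/

/-- `Within f n a b`: the transition function `f` leads from `a` to `b` in at most `n` steps. -/
def Within {σ : Type} (f : σ → Option σ) (n : ℕ) (a b : σ) : Prop :=
  ∃ k ≤ n, (flip bind f)^[k] (some a) = some b

lemma Within.trans {σ : Type} {f : σ → Option σ} {m n : ℕ} {a b c : σ}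
    (h₁ : Within f m a b) (h₂ : Within f n b c) : Within f (m + n) a c := by
  obtain ⟨i, hi, h₁⟩ := h₁
  obtain ⟨j, hj, h₂⟩ := h₂
  exact ⟨j + i, by omega, by rw [Function.iterate_add_apply, h₁, h₂]⟩

lemma Within.mono {σ : Type} {f : σ → Option σ} {m n : ℕ} {a b : σ}
    (h : Within f m a b) (hmn : m ≤ n) : Within f n a b :=
  let ⟨k, hk, e⟩ := h
  ⟨k, hk.trans hmn, e⟩

lemma Within.single {σ : Type} {f : σ → Option σ} {a b : σ} (h : f a = some b) :
    Within f 1 a b := ⟨1, le_rfl, h⟩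

lemma Within.head {σ : Type} {f : σ → Option σ} {n : ℕ} {a b c : σ} (h : f a = some b)
    (h₂ : Within f n b c) : Within f (n + 1) a c :=
  ((Within.single h).trans h₂).mono (by omega)

/-! ### Compilation to stack machines -/

open Turing

/-- The three stacks of the machine: the input and output, and two stacks between which the columns
of the memory are moved. When no pass is going on, all columns are on `low`, lowest digits on
top. -/
inductive Stack
  | io
  | low
  | high
  deriving DecidableEq

instance : Fintype Stack := ⟨{.io, .low, .high}, fun k => by cases k <;> simp⟩

/-- The alphabets of the three stacks. -/
abbrev Stack.Alphabet (V : Type) : Stack → Type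
  | .io => Bool
  | .low => Column V
  | .high => Column V

/-- The internal memory of the machine: the flag, and a symbol in transit. -/
abbrev Buffer (V : Type) := Bool × Option (Column V)

section Compile

variable {V : Type}

/-- The contents of the three stacks. -/
def contents (i : List Bool) (a b : List (Column V)) : ∀ k : Stack, List (k.Alphabet V)
  | .io => i
  | .low => a
  | .high => b

@[simp] lemma contents_io (i : List Bool) (a b : List (Column V)) : contents i a b .io = i := rfl
@[simp] lemma contents_low (i : List Bool) (a b : List (Column V)) : contents i a b .low = a := rfl
@[simp] lemma contents_high (i : List Bool) (a b : List (Column V)) :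
    contents i a b .high = b := rfl

@[simp] lemma update_contents_io (i : List Bool) (a b : List (Column V)) (x : List Bool) :
    Function.update (contents i a b) .io x = contents x a b := by
  funext k; cases k <;> rfl

@[simp] lemma update_contents_low (i : List Bool) (a b x : List (Column V)) :
    Function.update (contents i a b) .low x = contents i x b := by
  funext k; cases k <;> rfl

@[simp] lemma update_contents_high (i : List Bool) (a b x : List (Column V)) :
    Function.update (contents i a b) .high x = contents i a x := by
  funext k; cases k <;> rfl

/-- The labels of the code of a program. An instruction has one label for the pass that moves the
columns from `low` to `high` and one for the pass back; a branch on the flag has the label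
`none`. -/
def Cmd.Label : Cmd V → Type
  | .op _ => Bool
  | .flag _ => Unit
  | .seq c d => c.Label ⊕ d.Label
  | .ite c d => Option (c.Label ⊕ d.Label)
  | .loop c d => Option (c.Label ⊕ d.Label)

/-- There are finitely many labels. -/
@[reducible] def Cmd.fintypeLabel : (c : Cmd V) → Fintype c.Label
  | .op _ => inferInstanceAs (Fintype Bool)
  | .flag _ => inferInstanceAs (Fintype Unit)
  | .seq c d =>
    letI := c.fintypeLabel
    letI := d.fintypeLabel
    inferInstanceAs (Fintype (c.Label ⊕ d.Label))
  | .ite c d =>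
    letI := c.fintypeLabel
    letI := d.fintypeLabel
    inferInstanceAs (Fintype (Option (c.Label ⊕ d.Label)))
  | .loop c d =>
    letI := c.fintypeLabel
    letI := d.fintypeLabel
    inferInstanceAs (Fintype (Option (c.Label ⊕ d.Label)))

instance (c : Cmd V) : Fintype c.Label := c.fintypeLabel

/-- The label at which the code of a program is entered. -/
def Cmd.entry : (c : Cmd V) → c.Label
  | .op _ => false
  | .flag _ => ()
  | .seq c _ => .inl c.entry
  | .ite _ _ => none
  | .loop c _ => some (.inl c.entry)

variable [DecidableEq V]

/-- The code of a program as part of a machine with labels `Λ`: `emb` places the labels of the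
program among those of the machine, and control goes to `exit` when the program has ended. -/
def Cmd.code {Λ : Type} : (c : Cmd V) → (c.Label → Λ) → Λ → c.Label →
    TM2.Stmt (Stack.Alphabet V) Λ (Buffer V)
  | .op o, emb, exit, l => match l with
    | false => .pop .low
        (fun s x => match x with
          | none => s
          | some c => ((o.digit s.1 c).1, some (o.digit s.1 c).2))
        (.branch (fun s => s.2.isSome)
          (.push .high (fun s => s.2.getD fun _ => false)
            (.load (fun s => (s.1, none)) (.goto fun _ => emb false)))
          (.goto fun _ => emb true))
    | true => .pop .high (fun s x => (s.1, x))
        (.branch (fun s => s.2.isSome)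
          (.push .low (fun s => s.2.getD fun _ => false)
            (.load (fun s => (s.1, none)) (.goto fun _ => emb true)))
          (.goto fun _ => exit))
  | .flag b, _, exit, _ => .load (fun s => (b, s.2)) (.goto fun _ => exit)
  | .seq c d, emb, exit, l => match l with
    | .inl l => c.code (fun x => emb (.inl x)) (emb (.inr d.entry)) l
    | .inr l => d.code (fun x => emb (.inr x)) exit l
  | .ite c d, emb, exit, l => match l with
    | none => .branch (fun s => s.1) (.goto fun _ => emb (some (.inl c.entry)))
        (.goto fun _ => emb (some (.inr d.entry)))
    | some (.inl l) => c.code (fun x => emb (some (.inl x))) exit l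
    | some (.inr l) => d.code (fun x => emb (some (.inr x))) exit l
  | .loop c d, emb, exit, l => match l with
    | none => .branch (fun s => s.1) (.goto fun _ => exit)
        (.goto fun _ => emb (some (.inr d.entry)))
    | some (.inl l) => c.code (fun x => emb (some (.inl x))) (emb none) l
    | some (.inr l) => d.code (fun x => emb (some (.inr x))) (emb (some (.inl c.entry))) l

variable {Λ : Type} (M : Λ → TM2.Stmt (Stack.Alphabet V) Λ (Buffer V))

lemma within_forward_pass (o : Op V) (emb : (Cmd.op o).Label → Λ) (exit : Λ)
    (hM : ∀ l, M (emb l) = (Cmd.op o).code emb exit l) (i : List Bool) (f : Bool)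
    (l b : List (Column V)) :
    Within (TM2.step M) (l.length + 1) ⟨some (emb false), (f, none), contents i l b⟩
      ⟨some (emb true), ((o.pass f l).1, none), contents i [] ((o.pass f l).2.reverse ++ b)⟩ := by
  induction l generalizing f b with
  | nil => exact Within.single (by simp [hM false, Cmd.code, Op.pass])
  | cons c l ih =>
    refine Within.head ?_ (by simpa [Op.pass] using ih (o.digit f c).1 ((o.digit f c).2 :: b))
    simp [hM false, Cmd.code]

lemma within_backward_pass (o : Op V) (emb : (Cmd.op o).Label → Λ) (exit : Λ)
    (hM : ∀ l, M (emb l) = (Cmd.op o).code emb exit l) (i : List Bool) (f : Bool)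
    (l b : List (Column V)) :
    Within (TM2.step M) (l.length + 1) ⟨some (emb true), (f, none), contents i b l⟩
      ⟨some exit, (f, none), contents i (l.reverse ++ b) []⟩ := by
  induction l generalizing b with
  | nil => exact Within.single (by simp [hM true, Cmd.code])
  | cons c l ih =>
    refine Within.head ?_ (by simpa using ih (c :: b))
    simp [hM true, Cmd.code]

/-- The machine follows the abstract execution of a program, and each counted instruction costs it
at most `2 * W + 2` steps. -/
lemma Exec.within {W t : ℕ} {c : Cmd V} {s s' : State V} (h : Exec W c t s s')
    (emb : c.Label → Λ) (exit : Λ) (hM : ∀ l, M (emb l) = c.code emb exit l) (i : List Bool)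
    (l : List (Column V)) (hl : l.length = W) (hs : registers l = s.1) :
    ∃ l' : List (Column V), l'.length = W ∧ registers l' = s'.1 ∧
      Within (TM2.step M) ((2 * W + 2) * t) ⟨some (emb c.entry), (s.2, none), contents i l []⟩
        ⟨some exit, (s'.2, none), contents i l' []⟩ := by
  induction h generalizing exit l with
  | op o s =>
    subst hl
    obtain ⟨r, f⟩ := s
    obtain rfl : registers l = r := hs
    have e := o.eval_registers f l
    refine ⟨(o.pass f l).2, o.length_pass f l, by rw [e], ?_⟩
    have h₁ := within_forward_pass M o emb exit hM i f l []
    have h₂ := within_backward_pass M o emb exit hM i (o.pass f l).1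
      ((o.pass f l).2.reverse ++ []) []
    rw [e]
    exact (h₁.trans (by simpa using h₂)).mono (by simp [o.length_pass]; omega)
  | flag b s =>
    exact ⟨l, hl, hs, (Within.single (by simp [hM (), Cmd.code, Cmd.entry])).mono (by omega)⟩
  | seq _ _ ih₁ ih₂ =>
    obtain ⟨l₁, hl₁, hs₁, w₁⟩ := ih₁ (fun x => emb (.inl x)) _ (fun x => hM (.inl x)) l hl hs
    obtain ⟨l₂, hl₂, hs₂, w₂⟩ := ih₂ (fun x => emb (.inr x)) _ (fun x => hM (.inr x)) l₁ hl₁ hs₁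
    exact ⟨l₂, hl₂, hs₂, (w₁.trans w₂).mono (by rw [mul_add])⟩
  | ite_true hf _ ih =>
    obtain ⟨l₁, hl₁, hs₁, w₁⟩ :=
      ih (fun x => emb (some (.inl x))) _ (fun x => hM (some (.inl x))) l hl hs
    refine ⟨l₁, hl₁, hs₁, (Within.head ?_ w₁).mono (by rw [mul_add]; omega)⟩
    simp [hM none, Cmd.code, Cmd.entry, hf]
  | ite_false hf _ ih =>
    obtain ⟨l₁, hl₁, hs₁, w₁⟩ :=
      ih (fun x => emb (some (.inr x))) _ (fun x => hM (some (.inr x))) l hl hs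
    refine ⟨l₁, hl₁, hs₁, (Within.head ?_ w₁).mono (by rw [mul_add]; omega)⟩
    simp [hM none, Cmd.code, Cmd.entry, hf]
  | loop_done _ hf ih =>
    obtain ⟨l₁, hl₁, hs₁, w₁⟩ :=
      ih (fun x => emb (some (.inl x))) _ (fun x => hM (some (.inl x))) l hl hs
    refine ⟨l₁, hl₁, hs₁, (w₁.trans (Within.single ?_)).mono (by rw [mul_add]; omega)⟩
    simp [hM none, Cmd.code, hf]
  | loop_again _ hf _ _ ih₁ ih₂ ih₃ =>
    obtain ⟨l₁, hl₁, hs₁, w₁⟩ :=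
      ih₁ (fun x => emb (some (.inl x))) _ (fun x => hM (some (.inl x))) l hl hs
    obtain ⟨l₂, hl₂, hs₂, w₂⟩ :=
      ih₂ (fun x => emb (some (.inr x))) _ (fun x => hM (some (.inr x))) l₁ hl₁ hs₁
    obtain ⟨l₃, hl₃, hs₃, w₃⟩ := ih₃ emb exit hM l₂ hl₂ hs₂
    refine ⟨l₃, hl₃, hs₃, (w₁.trans (Within.head ?_ (w₂.trans w₃))).mono ?_⟩
    · simp [hM none, Cmd.code, hf]
    · simp only [mul_add]; omega

end Compile

/-! ### Input, output and memory -/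

section Machine

variable {V : Type} [DecidableEq V]

/-- The labels of the code that moves the input into the memory, and the output out of it. The loop
`trim` skips the leading zeros of the output, and `write` puts out the digits after them. -/
inductive PortLabel
  | start
  | read
  | rewind
  | finish
  | trim
  | write
  deriving DecidableEq

instance : Fintype PortLabel :=
  ⟨{.start, .read, .rewind, .finish, .trim, .write}, fun k => by cases k <;> simp⟩

/-- A statement that puts `w` columns of zeros on the stack `low`. -/
def pushZeros {Λ : Type} : ℕ → TM2.Stmt (Stack.Alphabet V) Λ (Buffer V) →
    TM2.Stmt (Stack.Alphabet V) Λ (Buffer V)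
  | 0, q => q
  | w + 1, q => .push .low (fun _ _ => false) (pushZeros w q)

omit [DecidableEq V] in
lemma stepAux_pushZeros {Λ : Type} (w : ℕ) (q : TM2.Stmt (Stack.Alphabet V) Λ (Buffer V))
    (s : Buffer V) (i : List Bool) (a b : List (Column V)) :
    TM2.stepAux (pushZeros w q) s (contents i a b) =
      TM2.stepAux q s (contents i (List.replicate w (fun _ => false) ++ a) b) := by
  induction w generalizing a with
  | zero => rfl
  | succ w ih =>
    have : List.replicate w (fun _ : V => false) ++ (fun _ => false) :: a =
        List.replicate (w + 1) (fun _ => false) ++ a := by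
      rw [List.replicate_succ']; simp
    simp only [pushZeros, TM2.stepAux, update_contents_low, contents_low, ih, this]

/-- The code of a machine that runs the program `c` with its input in the register `X` and with `w`
columns of zeros per digit of the input as additional room, and that outputs the register `Y`. -/
def machineCode (c : Cmd V) (X Y : V) (w : ℕ) : PortLabel ⊕ c.Label →
    TM2.Stmt (Stack.Alphabet V) (PortLabel ⊕ c.Label) (Buffer V)
  | .inl .start => pushZeros w (.goto fun _ => .inl .read)
  | .inl .read => .pop .io (fun s x => (s.1, x.map fun b => Function.update (fun _ => false) X b))
      (.branch (fun s => s.2.isSome)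
        (.push .high (fun s => s.2.getD fun _ => false)
          (.load (fun s => (s.1, none)) (pushZeros w (.goto fun _ => .inl .read))))
        (.goto fun _ => .inl .rewind))
  | .inl .rewind => .pop .high (fun s x => (s.1, x))
      (.branch (fun s => s.2.isSome)
        (.push .low (fun s => s.2.getD fun _ => false)
          (.load (fun s => (s.1, none)) (.goto fun _ => .inl .rewind)))
        (.goto fun _ => .inr c.entry))
  | .inl .finish => .pop .low (fun s x => (s.1, x))
      (.branch (fun s => s.2.isSome)
        (.push .high (fun s => s.2.getD fun _ => false)
          (.load (fun s => (s.1, none)) (.goto fun _ => .inl .finish)))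
        (.goto fun _ => .inl .trim))
  | .inl .trim => .pop .high (fun s x => (s.1, x))
      (.branch (fun s => s.2.isSome)
        (.branch (fun s => (s.2.getD fun _ => false) Y)
          (.push .io (fun _ => true) (.load (fun s => (s.1, none)) (.goto fun _ => .inl .write)))
          (.load (fun s => (s.1, none)) (.goto fun _ => .inl .trim)))
        (.load (fun _ => (false, none)) .halt))
  | .inl .write => .pop .high (fun s x => (s.1, x))
      (.branch (fun s => s.2.isSome)
        (.push .io (fun s => (s.2.getD fun _ => false) Y)
          (.load (fun s => (s.1, none)) (.goto fun _ => .inl .write)))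
        (.load (fun _ => (false, none)) .halt))
  | .inr l => c.code .inr (.inl .finish) l

variable (c : Cmd V) (X Y : V) (w : ℕ)

/-- The columns of a memory that holds the number with the given digits in the register `X`. -/
def inputColumns (X : V) (i : List Bool) : List (Column V) :=
  i.map fun b => Function.update (fun _ => false) X b

lemma within_read (i : List Bool) (a b : List (Column V)) :
    Within (TM2.step (machineCode c X Y w)) (i.length + 1)
      ⟨some (.inl .read), (false, none), contents i a b⟩
      ⟨some (.inl .rewind), (false, none),
        contents [] (List.replicate (i.length * w) (fun _ => false) ++ a)
          ((inputColumns X i).reverse ++ b)⟩ := by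
  induction i generalizing a b with
  | nil => exact Within.single (by simp [machineCode, inputColumns])
  | cons d i ih =>
    have h := ih (List.replicate w (fun _ => false) ++ a)
      (Function.update (fun _ => false) X d :: b)
    rw [← List.append_assoc, ← List.replicate_add] at h
    refine Within.head ?_ (by simpa [inputColumns, add_mul] using h)
    simp [machineCode, stepAux_pushZeros]

lemma within_rewind (a b : List (Column V)) :
    Within (TM2.step (machineCode c X Y w)) (b.length + 1)
      ⟨some (.inl .rewind), (false, none), contents [] a b⟩
      ⟨some (.inr c.entry), (false, none), contents [] (b.reverse ++ a) []⟩ := by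
  induction b generalizing a with
  | nil => exact Within.single (by simp [machineCode])
  | cons d b ih =>
    refine Within.head ?_ (by simpa using ih (d :: a))
    simp [machineCode]

lemma within_finish (f : Bool) (a b : List (Column V)) :
    Within (TM2.step (machineCode c X Y w)) (a.length + 1)
      ⟨some (.inl .finish), (f, none), contents [] a b⟩
      ⟨some (.inl .trim), (f, none), contents [] [] (a.reverse ++ b)⟩ := by
  induction a generalizing b with
  | nil => exact Within.single (by simp [machineCode])
  | cons d a ih =>
    refine Within.head ?_ (by simpa using ih (d :: b))
    simp [machineCode]

lemma within_write (f : Bool) (i : List Bool) (b : List (Column V)) :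
    Within (TM2.step (machineCode c X Y w)) (b.length + 1)
      ⟨some (.inl .write), (f, none), contents i [] b⟩
      ⟨none, (false, none), contents ((b.map fun d => d Y).reverse ++ i) [] []⟩ := by
  induction b generalizing i with
  | nil => exact Within.single (by simp [machineCode])
  | cons d b ih =>
    refine Within.head ?_ (by simpa using ih (d Y :: i))
    simp [machineCode]

lemma within_trim (f : Bool) (b : List (Column V)) :
    Within (TM2.step (machineCode c X Y w)) (b.length + 1)
      ⟨some (.inl .trim), (f, none), contents [] [] b⟩
      ⟨none, (false, none), contents ((b.map fun d => d Y).dropWhile (! ·)).reverse [] []⟩ := by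
  induction b with
  | nil => exact Within.single (by simp [machineCode])
  | cons d b ih =>
    cases hd : d Y with
    | false =>
      refine Within.head ?_ (by simpa [hd] using ih)
      simp [machineCode, hd]
    | true =>
      refine Within.head ?_ (by simpa [hd] using within_write c X Y w f [true] b)
      simp [machineCode, hd]

end Machine

open Turing Computability

section Encoding

variable {V : Type}

lemma encodeNat_bit (b : Bool) (n : ℕ) :
    encodeNat (b.toNat + 2 * n) = if b = false ∧ n = 0 then [] else b :: encodeNat n := by
  have hp : ∀ p : PosNum, encodeNat p = encodePosNum p := fun p => by
    rw [encodeNat, PosNum.of_to_nat]; rfl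
  obtain ⟨N, rfl⟩ : ∃ N : Num, (N : ℕ) = n := ⟨(n : Num), Num.to_of_nat n⟩
  cases N with
  | zero => cases b <;> rfl
  | pos p =>
    have hpos : ((Num.pos p : Num) : ℕ) ≠ 0 := (PosNum.to_nat_pos p).ne'
    have hq : b.toNat + 2 * ((Num.pos p : Num) : ℕ) = (PosNum.bit b p : ℕ) := by
      cases b <;> simp [PosNum.bit, PosNum.cast_bit0, PosNum.cast_bit1] <;> omega
    rw [if_neg (by tauto), hq, hp, Num.cast_pos, hp]
    cases b <;> rfl

/-- The binary expansion of the number stored in a row consists of the digits of the row without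
the leading zeros. -/
lemma encodeNat_rowValue (v : V) (l : List (Column V)) :
    encodeNat (rowValue v l) = ((l.reverse.map fun d => d v).dropWhile (! ·)).reverse := by
  induction l with
  | nil => rfl
  | cons c l ih =>
    rw [rowValue, encodeNat_bit, ih]
    have hz : rowValue v l = 0 ↔ (l.reverse.map fun d => d v).dropWhile (! ·) = [] := by
      rw [← List.reverse_eq_nil_iff, ← ih]
      constructor
      · intro h; rw [h]; rfl
      · intro h
        have := congrArg decodeNat h
        rw [decode_encodeNat] at this
        rw [this]; rfl
    rw [List.reverse_cons, List.map_append, List.dropWhile_append]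
    by_cases h0 : (l.reverse.map fun d => d v).dropWhile (! ·) = []
    · rw [h0] at hz ⊢
      cases hc : c v <;> simp [hz, hc]
    · have h1 : rowValue v l ≠ 0 := fun h => h0 (hz.1 h)
      rw [if_neg (by tauto), if_neg (by simpa [List.isEmpty_iff] using h0)]
      simp

lemma rowValue_append_zeros (v : V) (l : List (Column V)) (n : ℕ) :
    rowValue v (l ++ List.replicate n fun _ => false) = rowValue v l := by
  induction l with
  | nil => induction n with
    | zero => rfl
    | succ n ih => simpa [List.replicate_succ, rowValue] using ih
  | cons c l ih => simp [rowValue, ih]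

variable [DecidableEq V]

lemma rowValue_inputColumns_of_ne {v X : V} (hv : v ≠ X) (i : List Bool) :
    rowValue v (inputColumns X i) = 0 := by
  induction i with
  | nil => rfl
  | cons d i ih => simpa [inputColumns, rowValue, hv] using ih

lemma rowValue_inputColumns (X : V) (x : ℕ) : rowValue X (inputColumns X (encodeNat x)) = x := by
  have : ∀ p : PosNum, rowValue X (inputColumns X (encodePosNum p)) = p := by
    intro p
    induction p with
    | one => simp [encodePosNum, inputColumns, rowValue]
    | bit0 p ih =>
      simp only [inputColumns] at ih
      simp [encodePosNum, inputColumns, rowValue, ih]; omega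
    | bit1 p ih =>
      simp only [inputColumns] at ih
      simp [encodePosNum, inputColumns, rowValue, ih]; omega
  rw [encodeNat]
  conv_rhs => rw [← Num.to_of_nat x]
  cases (x : Num) with
  | zero => rfl
  | pos p => simpa [encodeNum] using this p

lemma registers_input (X : V) (x n : ℕ) :
    registers (inputColumns X (encodeNat x) ++ List.replicate n fun _ => false) =
      Function.update (fun _ => 0) X x := by
  funext v
  rw [registers, rowValue_append_zeros]
  by_cases hv : v = X
  · subst hv; simp [rowValue_inputColumns]
  · simp [hv, rowValue_inputColumns_of_ne]

end Encoding

section Space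

/-- The number of symbols that a statement puts on the stacks, at most. -/
def pushes {K : Type} {Γ : K → Type} {Λ σ : Type} : TM2.Stmt Γ Λ σ → ℕ
  | .push _ _ q => pushes q + 1
  | .peek _ _ q => pushes q
  | .pop _ _ q => pushes q
  | .load _ q => pushes q
  | .branch _ q₁ q₂ => pushes q₁ + pushes q₂
  | .goto _ => 0
  | .halt => 0

lemma sum_length_stepAux_le {K : Type} [DecidableEq K] [Fintype K] {Γ : K → Type} {Λ σ : Type}
    (q : TM2.Stmt Γ Λ σ) (v : σ) (S : ∀ k, List (Γ k)) :
    ∑ k, ((TM2.stepAux q v S).stk k).length ≤ ∑ k, (S k).length + pushes q := by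
  induction q generalizing v S with
  | push k f q ih =>
    refine (ih _ _).trans ?_
    have : ∀ j, (Function.update S k (f v :: S k) j).length =
        (S j).length + if j = k then 1 else 0 := by
      intro j
      by_cases h : j = k
      · subst h; simp
      · simp [h]
    simp [this, Finset.sum_add_distrib, pushes]
    omega
  | peek k f q ih => exact ih _ _
  | pop k f q ih =>
    refine (ih _ _).trans (Nat.add_le_add_right (Finset.sum_le_sum fun j _ => ?_) _)
    by_cases h : j = k
    · subst h; simp
    · simp [h]
  | load f q ih => exact ih _ _
  | branch f q₁ q₂ ih₁ ih₂ =>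
    have h₁ := ih₁ v S
    have h₂ := ih₂ v S
    simp only [TM2.stepAux, pushes]
    cases f v <;> simp <;> omega
  | goto f => simp [pushes]
  | halt => simp [pushes]

lemma exists_sum_length_step_le (tm : FinTM2) : ∃ C : ℕ, ∀ a b : tm.Cfg, tm.step a = some b →
    ∑ k ∈ @Finset.univ tm.K tm.kFin, (b.stk k).length ≤
      ∑ k ∈ @Finset.univ tm.K tm.kFin, (a.stk k).length + C := by
  let _ := tm.kFin
  let _ := tm.ΛFin
  refine ⟨∑ l, pushes (tm.m l), ?_⟩
  rintro ⟨l, v, S⟩ b h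
  cases l with
  | none => cases h
  | some l =>
    obtain rfl : TM2.stepAux (tm.m l) v S = b := Option.some.inj h
    exact (sum_length_stepAux_le (tm.m l) v S).trans (Nat.add_le_add_left
      (Finset.single_le_sum (f := fun l => pushes (tm.m l)) (fun _ _ => Nat.zero_le _)
        (Finset.mem_univ l)) _)

/-- Along a run that halts within `n` steps, the number of symbols on the stacks grows by a bounded
amount in each step. -/
lemma sum_length_le_of_within {tm : FinTM2} {C : ℕ}
    (hC : ∀ a b : tm.Cfg, tm.step a = some b →
      ∑ k ∈ @Finset.univ tm.K tm.kFin, (b.stk k).length ≤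
        ∑ k ∈ @Finset.univ tm.K tm.kFin, (a.stk k).length + C)
    {n : ℕ} {a b c : tm.Cfg} (h : Within tm.step n a b) (hb : tm.step b = none)
    (hc : StateTransition.Reaches tm.step a c) :
    ∑ k ∈ @Finset.univ tm.K tm.kFin, (c.stk k).length ≤
      ∑ k ∈ @Finset.univ tm.K tm.kFin, (a.stk k).length + C * n := by
  induction n generalizing a with
  | zero =>
    obtain ⟨k, hk, h⟩ := h
    obtain rfl : k = 0 := by omega
    obtain rfl : a = b := by simpa using h
    rcases Relation.ReflTransGen.cases_head hc with rfl | ⟨d, hd, _⟩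
    · simp
    · have hd : tm.step a = some d := hd
      rw [hb] at hd
      cases hd
  | succ n ih =>
    rcases Relation.ReflTransGen.cases_head hc with rfl | ⟨d, hd, hdc⟩
    · simp
    · have hd : tm.step a = some d := hd
      obtain ⟨k, hk, h⟩ := h
      cases k with
      | zero =>
        obtain rfl : a = b := by simpa using h
        rw [hb] at hd
        cases hd
      | succ k =>
        have h' : Within tm.step n d b := by
          refine ⟨k, by omega, ?_⟩
          change (flip bind tm.step)^[k] (tm.step a) = some b at h
          rwa [hd] at h
        have := ih h' hdc
        have := hC a d hd
        rw [mul_add]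
        omega

end Space

section Machine

variable {V : Type} [DecidableEq V] [Fintype V]

/-- The machine that runs the program `c` with its input in the register `X` and its output in the
register `Y`. -/
def machine (c : Cmd V) (X Y : V) (w : ℕ) : FinTM2 where
  K := Stack
  k₀ := .io
  k₁ := .io
  Γ := Stack.Alphabet V
  Λ := PortLabel ⊕ c.Label
  main := .inl .start
  σ := Buffer V
  initialState := (false, none)
  Γk₀Fin := inferInstanceAs (Fintype Bool)
  m := machineCode c X Y w

lemma initList_machine (c : Cmd V) (X Y : V) (w : ℕ) (i : List Bool) :
    initList (machine c X Y w) i = ⟨some (.inl .start), (false, none), contents i [] []⟩ := by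
  refine congrArg (fun S => (⟨some (.inl .start), (false, none), S⟩ :
    TM2.Cfg (Stack.Alphabet V) (PortLabel ⊕ c.Label) (Buffer V))) ?_
  funext k; cases k <;> rfl

lemma haltList_machine (c : Cmd V) (X Y : V) (w : ℕ) (i : List Bool) :
    haltList (machine c X Y w) i = ⟨none, (false, none), contents i [] []⟩ := by
  refine congrArg (fun S => (⟨none, (false, none), S⟩ :
    TM2.Cfg (Stack.Alphabet V) (PortLabel ⊕ c.Label) (Buffer V))) ?_
  funext k; cases k <;> rfl

lemma within_machine {c : Cmd V} {X Y : V} {w W x t : ℕ} {s : State V}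
    (hW : W = (encodeNat x).length + ((encodeNat x).length + 1) * w)
    (h : Exec W c t (Function.update (fun _ => 0) X x, false) s) :
    Within (machine c X Y w).step
      ((2 * w + 7) * (((encodeNat x).length + 1) * (t + 1)))
      (initList (machine c X Y w) (encodeNat x))
      (haltList (machine c X Y w) (encodeNat (s.1 Y))) := by
  rw [initList_machine, haltList_machine]
  set ℓ := (encodeNat x).length with hℓ
  have hlen : (inputColumns X (encodeNat x)).length = ℓ := by simp [inputColumns, hℓ]
  have h₀ : Within (TM2.step (machineCode c X Y w)) 1
      ⟨some (.inl .start), (false, none), contents (encodeNat x) [] []⟩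
      ⟨some (.inl .read), (false, none),
        contents (encodeNat x) (List.replicate w fun _ => false) []⟩ :=
    Within.single (by simp [machineCode, stepAux_pushZeros])
  have h₁ := within_read c X Y w (encodeNat x) (List.replicate w fun _ => false) []
  have h₂ := within_rewind c X Y w
    (List.replicate (ℓ * w) (fun _ => false) ++ List.replicate w fun _ => false)
    ((inputColumns X (encodeNat x)).reverse ++ [])
  rw [← List.replicate_add] at h₁ h₂
  simp only [List.append_nil, List.reverse_reverse, List.length_reverse, hlen] at h₁ h₂
  obtain ⟨l, hl, hs, h₃⟩ := h.within (machineCode c X Y w) .inr (.inl .finish) (fun _ => rfl) []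
    (inputColumns X (encodeNat x) ++ List.replicate (ℓ * w + w) fun _ => false)
    (by simp [hlen, hW]; ring) (registers_input X x _)
  have h₄ := within_finish c X Y w s.2 l []
  have h₅ := within_trim c X Y w s.2 (l.reverse ++ [])
  have hY : encodeNat (s.1 Y) =
      (((l.reverse ++ []).map fun d : Column V => d Y).dropWhile (! ·)).reverse := by
    rw [← hs, registers, encodeNat_rowValue]; simp
  rw [hY]
  refine ((h₀.trans h₁).trans ((h₂.trans h₃).trans (h₄.trans h₅))).mono ?_
  simp only [List.append_nil, List.length_reverse, hl, ← hℓ]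
  subst hW
  nlinarith [Nat.zero_le (ℓ * t), Nat.zero_le (ℓ * t * w), Nat.zero_le (ℓ * w), Nat.zero_le (w * t)]

/-- A program computes its function on a machine with time and space proportional to the number of
digits of the input times the number of instructions carried out. -/
theorem exists_computableInTimeAtMost (c : Cmd V) (X Y : V) (w : ℕ) (f t : ℕ → ℕ)
    (h : ∀ x W : ℕ, W = (encodeNat x).length + ((encodeNat x).length + 1) * w →
      ∃ t' ≤ t x, ∃ s : State V,
        Exec W c t' (Function.update (fun _ => 0) X x, false) s ∧ s.1 Y = f x) :
    ∃ C : ℕ, ComputableInTimeAtMost f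
      fun x => C * (((encodeNat x).length + 1) * (t x + 1)) := by
  obtain ⟨C, hC⟩ := exists_sum_length_step_le (machine c X Y w)
  refine ⟨(C + 1) * (2 * w + 7) + 1, machine c X Y w, Equiv.refl Bool, Equiv.refl Bool, ?_, ?_⟩
  · intro k
    change Finite (k.Alphabet V)
    cases k <;> infer_instance
  intro x
  obtain ⟨t', ht', s, hs, hf⟩ := h x _ rfl
  have hw := within_machine (Y := Y) rfl hs
  rw [hf] at hw
  set T := (2 * w + 7) * (((encodeNat x).length + 1) * (t x + 1)) with hT
  replace hw := hw.mono (show _ ≤ T by rw [hT]; gcongr)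
  have hi : (encodeNat x).map (Equiv.refl Bool).symm = encodeNat x := by simp
  have ho : (encodeNat (f x)).map (Equiv.refl Bool).symm = encodeNat (f x) := by simp
  have hle : (encodeNat x).length ≤ ((encodeNat x).length + 1) * (t x + 1) := by nlinarith
  constructor
  · obtain ⟨k, hk, e⟩ := hw
    refine ⟨⟨⟨k, ?_⟩, hk.trans ?_⟩⟩
    · refine Eq.trans ?_ (e.trans ?_)
      · exact congrArg (fun a => (flip bind _)^[k] (some (initList (machine c X Y w) a))) hi
      · exact congrArg (fun a => some (haltList (machine c X Y w) a)) ho.symm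
    · rw [hT]; nlinarith
  · intro d hd
    have hd' : StateTransition.Reaches (machine c X Y w).step
        (initList (machine c X Y w) (encodeNat x)) d := by
      refine Eq.subst (motive := fun a => StateTransition.Reaches (machine c X Y w).step
        (initList (machine c X Y w) a) d) hi hd
    have := sum_length_le_of_within hC hw (by rw [haltList_machine]; rfl) hd'
    refine this.trans ?_
    have e : ∑ k ∈ @Finset.univ (machine c X Y w).K (machine c X Y w).kFin,
        ((initList (machine c X Y w) (encodeNat x)).stk k).length = (encodeNat x).length := by
      rw [initList_machine]
      change ∑ k : Stack, (contents (V := V) (encodeNat x) [] [] k).length = _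
      simp [Finset.sum, Finset.univ, Fintype.elems]
    rw [e, hT]
    nlinarith

end Machine

/-! ### Timed correctness assertions -/

section Runs

variable {V : Type} [DecidableEq V] {W : ℕ}

/-- `Runs W c n s Q`: from the state `s`, the program `c` ends after at most `n` instructions in a
state that satisfies `Q`. -/
def Runs (W : ℕ) (c : Cmd V) (n : ℕ) (s : State V) (Q : State V → Prop) : Prop :=
  ∃ t ≤ n, ∃ s', Exec W c t s s' ∧ Q s'

lemma Runs.op {o : Op V} {s : State V} {Q : State V → Prop} (h : Q (o.eval W s)) :
    Runs W (.op o) 1 s Q := ⟨1, le_rfl, _, .op o s, h⟩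

lemma Runs.flag {b : Bool} {s : State V} {Q : State V → Prop} (h : Q (s.1, b)) :
    Runs W (.flag b) 1 s Q := ⟨1, le_rfl, _, .flag b s, h⟩

lemma Runs.mono {c : Cmd V} {m n : ℕ} {s : State V} {P Q : State V → Prop}
    (h : Runs W c m s P) (hmn : m ≤ n) (hPQ : ∀ s', P s' → Q s') : Runs W c n s Q :=
  let ⟨t, ht, s', e, hP⟩ := h
  ⟨t, ht.trans hmn, s', e, hPQ s' hP⟩

lemma Runs.mono_time {c : Cmd V} {m n : ℕ} {s : State V} {Q : State V → Prop}
    (h : Runs W c m s Q) (hmn : m ≤ n) : Runs W c n s Q := h.mono hmn fun _ h => h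

lemma Runs.seq {c d : Cmd V} {m n : ℕ} {s : State V} {Q : State V → Prop}
    (h : Runs W c m s fun s' => Runs W d n s' Q) : Runs W (.seq c d) (m + n) s Q :=
  let ⟨_, h₁, _, e₁, _, h₂, s₂, e₂, hQ⟩ := h
  ⟨_, add_le_add h₁ h₂, s₂, .seq e₁ e₂, hQ⟩

lemma Runs.ite {c d : Cmd V} {n : ℕ} {s : State V} {Q : State V → Prop}
    (h₁ : s.2 = true → Runs W c n s Q) (h₂ : s.2 = false → Runs W d n s Q) :
    Runs W (.ite c d) (1 + n) s Q := by
  cases hs : s.2 with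
  | true =>
    obtain ⟨t, ht, s', e, hQ⟩ := h₁ hs
    exact ⟨1 + t, by omega, s', .ite_true hs e, hQ⟩
  | false =>
    obtain ⟨t, ht, s', e, hQ⟩ := h₂ hs
    exact ⟨1 + t, by omega, s', .ite_false hs e, hQ⟩

lemma Runs.loop {c d : Cmd V} {m n k : ℕ} {s : State V} {Q : State V → Prop}
    (h : Runs W c m s fun s₁ => (s₁.2 = true → Q s₁) ∧
      (s₁.2 = false → Runs W d n s₁ fun s₂ => Runs W (.loop c d) k s₂ Q)) :
    Runs W (.loop c d) (m + 1 + (n + k)) s Q := by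
  obtain ⟨t, ht, s₁, e, h₁, h₂⟩ := h
  cases hs : s₁.2 with
  | true => exact ⟨t + 1, by omega, s₁, .loop_done e hs, h₁ hs⟩
  | false =>
    obtain ⟨t₂, ht₂, s₂, e₂, t₃, ht₃, s₃, e₃, hQ⟩ := h₂ hs
    exact ⟨_, by omega, s₃, .loop_again e hs e₂ e₃, hQ⟩

lemma Op.eval_lt (o : Op V) {s : State V} (h : ∀ v, s.1 v < 2 ^ W) (v : V) :
    (o.eval W s).1 v < 2 ^ W := by
  have hp : 0 < 2 ^ W := by positivity
  cases o with
  | lt u w => exact h v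
  | add u w | sub u w | copy u w =>
    simp only [Op.eval, Function.update_apply]
    split_ifs
    · first | exact Nat.mod_lt _ hp | exact h w
    · exact h v

lemma Exec.lt {c : Cmd V} {t : ℕ} {s s' : State V} (h : Exec W c t s s')
    (hs : ∀ v, s.1 v < 2 ^ W) : ∀ v, s'.1 v < 2 ^ W := by
  induction h with
  | op o s => exact o.eval_lt hs
  | flag b s => exact hs
  | seq _ _ ih₁ ih₂ => exact ih₂ (ih₁ hs)
  | ite_true _ _ ih => exact ih hs
  | ite_false _ _ ih => exact ih hs
  | loop_done _ _ ih => exact ih hs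
  | loop_again _ _ _ _ ih₁ ih₂ ih₃ => exact ih₃ (ih₂ (ih₁ hs))

/-! ### Scanning the digits of a register -/

/-- The program that runs `body` once for every digit of the register `a`, highest digit first,
with the digit in the flag. The digits are shifted out of `a`; the register `c` holds a single
digit `1`, whose loss ends the scan. -/
def Cmd.scan (a c : V) (body : Cmd V) : Cmd V :=
  .seq (.flag false) (.seq (.op (.sub c c)) (.seq (.flag true) (.seq (.op (.add c c))
    (.loop (.seq (.flag false) (.seq (.op (.add a a)) (.seq body
      (.seq (.flag false) (.op (.add c c)))))) (.flag false)))))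

variable {a c : V} {body : Cmd V} {A n : ℕ} {Inv : ℕ → (V → ℕ) → Prop}

lemma runs_scan_step (hac : a ≠ c)
    (hbody : ∀ m s, Inv m s.1 → 2 * m + s.2.toNat ≤ A →
      Runs W body n s fun s' =>
        Inv (2 * m + s.2.toNat) s'.1 ∧ s'.1 a = s.1 a ∧ s'.1 c = s.1 c)
    (ha : ∀ m r x, Inv m r → Inv m (Function.update r a x))
    (hc : ∀ m r x, Inv m r → Inv m (Function.update r c x)) {k j : ℕ} (hkj : k + 1 + j = W)
    {s : State V} (hsc : s.1 c = 2 ^ j) (hsa : s.1 a = A % 2 ^ (k + 1) * 2 ^ j)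
    (hs : Inv (A / 2 ^ (k + 1)) s.1) :
    Runs W (.seq (.flag false) (.seq (.op (.add a a)) (.seq body
      (.seq (.flag false) (.op (.add c c)))))) (n + 4) s fun s' =>
        s'.1 c = 2 ^ (j + 1) % 2 ^ W ∧ s'.2 = decide (2 ^ W ≤ 2 ^ (j + 1)) ∧
        s'.1 a = A % 2 ^ k * 2 ^ (j + 1) ∧ Inv (A / 2 ^ k) s'.1 := by
  obtain ⟨β, hβ, hβ'⟩ : ∃ β : Bool, A / 2 ^ k % 2 = β.toNat ∧
      A % 2 ^ (k + 1) = A % 2 ^ k + 2 ^ k * β.toNat := by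
    refine ⟨decide (A / 2 ^ k % 2 = 1), ?_⟩
    rw [pow_succ, Nat.mod_mul]
    rcases Nat.mod_two_eq_zero_or_one (A / 2 ^ k) with h | h <;> simp [h]
  have hdiv : 2 * (A / 2 ^ (k + 1)) + β.toNat = A / 2 ^ k := by
    rw [pow_succ, ← Nat.div_div_eq_div_mul, ← hβ]; omega
  have hW : 2 ^ W = 2 ^ k * 2 ^ (j + 1) := by rw [← hkj, ← pow_add]; congr 1; ring
  have hlt : A % 2 ^ k * 2 ^ (j + 1) < 2 ^ W := by
    rw [hW]
    exact Nat.mul_lt_mul_of_pos_right (Nat.mod_lt _ (by positivity)) (by positivity)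
  have hadd : s.1 a + s.1 a + 0 = A % 2 ^ k * 2 ^ (j + 1) + 2 ^ W * β.toNat := by
    rw [hsa, hβ', hW]; ring
  refine Runs.mono_time (m := 1 + (1 + (n + (1 + 1))))
    (Runs.seq (Runs.flag (Runs.seq (Runs.op (Runs.seq ?_))))) (by omega)
  have hv : (s.1 a + s.1 a + 0) % 2 ^ W = A % 2 ^ k * 2 ^ (j + 1) := by
    rw [hadd, Nat.add_mul_mod_self_left, Nat.mod_eq_of_lt hlt]
  have hf : decide (2 ^ W ≤ s.1 a + s.1 a + 0) = β := by
    simp only [hadd]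
    cases β <;> simp [hlt]
  have he : (Op.add a a).eval W (s.1, false) =
      (Function.update s.1 a (A % 2 ^ k * 2 ^ (j + 1)), β) :=
    Prod.ext (congrArg (Function.update s.1 a) hv) hf
  rw [he]
  refine (hbody _ _ (ha _ _ _ hs) (by
    simp only [hdiv]; exact Nat.div_le_self _ _)).mono le_rfl ?_
  rintro s' ⟨h₁, h₂, h₃⟩
  simp only [hdiv, Function.update_self, Function.update_of_ne hac.symm] at h₁ h₂ h₃
  refine (Runs.seq (m := 1) (n := 1) (Runs.flag (Runs.op ?_)))
  have hc2 : s'.1 c + s'.1 c + 0 = 2 ^ (j + 1) := by rw [h₃, hsc]; ring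
  refine ⟨?_, ?_, ?_, hc _ _ _ h₁⟩
  · simp only [Op.eval, Function.update_self, Bool.toNat_false, hc2]
  · simp only [Op.eval, Bool.toNat_false, hc2]
  · simp only [Op.eval, Function.update_of_ne hac, h₂]

lemma runs_scan_loop (hac : a ≠ c)
    (hbody : ∀ m s, Inv m s.1 → 2 * m + s.2.toNat ≤ A →
      Runs W body n s fun s' =>
        Inv (2 * m + s.2.toNat) s'.1 ∧ s'.1 a = s.1 a ∧ s'.1 c = s.1 c)
    (ha : ∀ m r x, Inv m r → Inv m (Function.update r a x))
    (hc : ∀ m r x, Inv m r → Inv m (Function.update r c x)) (k j : ℕ) (hkj : k + 1 + j = W)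
    (s : State V) (hsc : s.1 c = 2 ^ j) (hsa : s.1 a = A % 2 ^ (k + 1) * 2 ^ j)
    (hs : Inv (A / 2 ^ (k + 1)) s.1) :
    Runs W (.loop (.seq (.flag false) (.seq (.op (.add a a)) (.seq body
      (.seq (.flag false) (.op (.add c c)))))) (.flag false)) ((k + 1) * (n + 6)) s
      fun s' => Inv A s'.1 := by
  induction k generalizing j s with
  | zero =>
    refine (Runs.loop (n := 0) (k := 0) ((runs_scan_step hac hbody ha hc hkj hsc hsa hs).mono
      le_rfl ?_)).mono_time (by omega)
    rintro s' ⟨-, h₂, -, h₄⟩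
    rw [show j + 1 = W by omega] at h₂
    refine ⟨fun _ => by simpa using h₄, fun h => by simp [h] at h₂⟩
  | succ k ih =>
    refine (Runs.loop (n := 1) (k := (k + 1) * (n + 6))
      ((runs_scan_step hac hbody ha hc hkj hsc hsa hs).mono le_rfl ?_)).mono
      (by nlinarith) fun _ h => h
    rintro s' ⟨h₁, h₂, h₃, h₄⟩
    have hlt : 2 ^ (j + 1) < 2 ^ W := Nat.pow_lt_pow_right (by norm_num) (by omega)
    rw [Nat.mod_eq_of_lt hlt] at h₁
    refine ⟨fun h => ?_, fun _ => Runs.flag (ih (j + 1) (by omega) _ h₁ h₃ h₄)⟩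
    rw [h] at h₂
    exact absurd hlt (by simpa using h₂.symm)

/-- If the body of a scan turns what holds for a number `m` into what holds for `m` with one more
binary digit, appended at the end, then the scan turns what holds for `0` into what holds for the
scanned number. -/
lemma Runs.scan (hW : 0 < W) (hac : a ≠ c)
    (hbody : ∀ m s, Inv m s.1 → 2 * m + s.2.toNat ≤ A →
      Runs W body n s fun s' =>
        Inv (2 * m + s.2.toNat) s'.1 ∧ s'.1 a = s.1 a ∧ s'.1 c = s.1 c)
    (ha : ∀ m r x, Inv m r → Inv m (Function.update r a x))
    (hc : ∀ m r x, Inv m r → Inv m (Function.update r c x)) {s : State V}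
    (hsa : s.1 a = A) (hA : A < 2 ^ W) (hs : Inv 0 s.1) {Q : State V → Prop}
    (hQ : ∀ s', Inv A s'.1 → Q s') :
    Runs W (.scan a c body) (W * (n + 6) + 4) s Q := by
  obtain ⟨k, rfl⟩ : ∃ k, W = k + 1 := ⟨W - 1, by omega⟩
  have h1 : 1 < 2 ^ (k + 1) := Nat.one_lt_two_pow (by omega)
  refine Runs.mono_time (m := 1 + (1 + (1 + (1 + (k + 1) * (n + 6))))) (Runs.seq (Runs.flag
    (Runs.seq (Runs.op (Runs.seq (Runs.flag (Runs.seq (Runs.op ?_)))))))) (by omega)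
  refine (runs_scan_loop hac hbody ha hc k 0 (by omega) _ ?_ ?_ ?_).mono le_rfl hQ
  · simp [Op.eval, Nat.mod_eq_of_lt h1]
  · simp [Op.eval, hac, hsa, Nat.mod_eq_of_lt hA]
  · rw [Nat.div_eq_of_lt hA]
    exact hc _ _ _ (hc _ _ _ hs)

end Runs

/-! ### Arithmetic on user registers -/

/-- The auxiliary registers of the arithmetic routines. -/
inductive Scratch
  | a
  | b
  | c
  | p
  | q
  | r
  | z
  deriving DecidableEq

instance : Fintype Scratch :=
  ⟨{.a, .b, .c, .p, .q, .r, .z}, fun k => by cases k <;> simp⟩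

section Computes

variable {U : Type} [DecidableEq U] {W : ℕ}

/-- `Computes W c n r Q`: whatever the flag and the auxiliary registers contain, from values `r` of
the user registers the program `c` ends after at most `n` instructions, with values of the user
registers and of the flag that satisfy `Q`. -/
def Computes (W : ℕ) (c : Cmd (Scratch ⊕ U)) (n : ℕ) (r : U → ℕ)
    (Q : (U → ℕ) → Bool → Prop) : Prop :=
  ∀ s : State (Scratch ⊕ U), (∀ v, s.1 v < 2 ^ W) → (∀ u, s.1 (.inr u) = r u) →
    Runs W c n s fun s' => Q (fun u => s'.1 (.inr u)) s'.2

lemma Computes.mono {c : Cmd (Scratch ⊕ U)} {m n : ℕ} {r : U → ℕ} {P Q : (U → ℕ) → Bool → Prop}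
    (h : Computes W c m r P) (hmn : m ≤ n) (hPQ : ∀ r' f, P r' f → Q r' f) :
    Computes W c n r Q :=
  fun s hs hr => (h s hs hr).mono hmn fun _ h => hPQ _ _ h

lemma Computes.mono_time {c : Cmd (Scratch ⊕ U)} {m n : ℕ} {r : U → ℕ}
    {Q : (U → ℕ) → Bool → Prop} (h : Computes W c m r Q) (hmn : m ≤ n) : Computes W c n r Q :=
  h.mono hmn fun _ _ h => h

lemma Computes.seq {c d : Cmd (Scratch ⊕ U)} {m n : ℕ} {r : U → ℕ} {Q : (U → ℕ) → Bool → Prop}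
    (h : Computes W c m r fun r' _ => Computes W d n r' Q) : Computes W (.seq c d) (m + n) r Q := by
  intro s hs hr
  obtain ⟨t, ht, s', e, hd⟩ := h s hs hr
  exact Runs.seq ⟨t, ht, s', e, hd s' (e.lt hs) fun _ => rfl⟩

/-- The program that runs `c` and then branches on the flag. -/
def Cmd.branch {V : Type} (c d e : Cmd V) : Cmd V := .seq c (.ite d e)

lemma Computes.branch {c d e : Cmd (Scratch ⊕ U)} {m n : ℕ} {r : U → ℕ}
    {Q : (U → ℕ) → Bool → Prop}
    (h : Computes W c m r fun r' f => (f = true → Computes W d n r' Q) ∧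
      (f = false → Computes W e n r' Q)) : Computes W (.branch c d e) (m + (1 + n)) r Q := by
  intro s hs hr
  obtain ⟨t, ht, s', ex, h₁, h₂⟩ := h s hs hr
  exact Runs.seq ⟨t, ht, s', ex, Runs.ite (fun hf => h₁ hf s' (ex.lt hs) fun _ => rfl)
    fun hf => h₂ hf s' (ex.lt hs) fun _ => rfl⟩

lemma Computes.loop {c d : Cmd (Scratch ⊕ U)} {m n k : ℕ} {r : U → ℕ}
    {Q : (U → ℕ) → Bool → Prop}
    (h : Computes W c m r fun r₁ f => (f = true → Q r₁ true) ∧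
      (f = false → Computes W d n r₁ fun r₂ _ => Computes W (.loop c d) k r₂ Q)) :
    Computes W (.loop c d) (m + 1 + (n + k)) r Q := by
  intro s hs hr
  obtain ⟨t, ht, s₁, e₁, h₁, h₂⟩ := h s hs hr
  refine Runs.loop ⟨t, ht, s₁, e₁, fun hf => ?_, fun hf => ?_⟩
  · rw [hf]; exact h₁ hf
  · obtain ⟨t₂, ht₂, s₂, e₂, hd⟩ := h₂ hf s₁ (e₁.lt hs) fun _ => rfl
    exact ⟨t₂, ht₂, s₂, e₂, hd s₂ ((e₂.lt) (e₁.lt hs)) fun _ => rfl⟩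

/-- An upper bound for the number of instructions in each of the arithmetic routines. -/
def routineCost (W : ℕ) : ℕ := 14 * W + 14

/-- Set a register to `0`. -/
def Cmd.zero (d : U) : Cmd (Scratch ⊕ U) := .seq (.flag false) (.op (.sub (.inr d) (.inr d)))

/-- Increase a register by `1`. -/
def Cmd.inc (d : U) : Cmd (Scratch ⊕ U) :=
  .seq (.flag false) (.seq (.op (.sub (.inl .z) (.inl .z)))
    (.seq (.flag true) (.op (.add (.inr d) (.inl .z)))))

/-- Add the register `v` to the register `d`. -/
def Cmd.add (d v : U) : Cmd (Scratch ⊕ U) := .seq (.flag false) (.op (.add (.inr d) (.inr v)))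

/-- Subtract the register `v` from the register `d`. -/
def Cmd.sub (d v : U) : Cmd (Scratch ⊕ U) := .seq (.flag false) (.op (.sub (.inr d) (.inr v)))

/-- Copy the register `v` to the register `d`. -/
def Cmd.copy (d v : U) : Cmd (Scratch ⊕ U) := .op (.copy (.inr d) (.inr v))

/-- Test whether the register `u` is smaller than the register `v`. -/
def Cmd.lt (u v : U) : Cmd (Scratch ⊕ U) := .seq (.flag false) (.op (.lt (.inr u) (.inr v)))

/-- Long multiplication: set the register `d` to the product of the registers `u` and `v`. -/
def Cmd.mul (d u v : U) : Cmd (Scratch ⊕ U) :=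
  .seq (.op (.copy (.inl .a) (.inr u))) (.seq (.op (.copy (.inl .b) (.inr v)))
    (.seq (.flag false) (.seq (.op (.sub (.inl .p) (.inl .p)))
      (.seq (.scan (.inl .a) (.inl .c)
        (.ite (.seq (.flag false) (.seq (.op (.add (.inl .p) (.inl .p)))
            (.seq (.flag false) (.op (.add (.inl .p) (.inl .b))))))
          (.seq (.flag false) (.op (.add (.inl .p) (.inl .p))))))
        (.op (.copy (.inr d) (.inl .p)))))))

/-- Long division: set the registers `d` and `m` to the quotient and the remainder of the registers
`u` and `v`. -/
def Cmd.divMod (d m u v : U) : Cmd (Scratch ⊕ U) :=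
  .seq (.op (.copy (.inl .a) (.inr u))) (.seq (.op (.copy (.inl .b) (.inr v)))
    (.seq (.flag false) (.seq (.op (.sub (.inl .q) (.inl .q)))
      (.seq (.flag false) (.seq (.op (.sub (.inl .r) (.inl .r)))
        (.seq (.scan (.inl .a) (.inl .c)
          (.seq (.op (.add (.inl .r) (.inl .r))) (.seq (.flag false)
            (.seq (.op (.lt (.inl .r) (.inl .b)))
              (.ite (.seq (.flag false) (.op (.add (.inl .q) (.inl .q))))
                (.seq (.flag false) (.seq (.op (.sub (.inl .r) (.inl .b)))
                  (.seq (.flag true) (.op (.add (.inl .q) (.inl .q)))))))))))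
          (.seq (.op (.copy (.inr d) (.inl .q))) (.op (.copy (.inr m) (.inl .r))))))))))

variable {r : U → ℕ} {Q : (U → ℕ) → Bool → Prop}

lemma Computes.zero {d : U} (hQ : Q (Function.update r d 0) false) :
    Computes W (.zero d) (routineCost W) r Q := by
  intro s hs hr
  have hc : s.1 ∘ Sum.inr = r := funext hr
  refine Runs.mono_time (Runs.seq (Runs.flag (Runs.op ?_))) (by unfold routineCost; omega)
  simpa [Op.eval, hc] using hQ

lemma Computes.inc {d : U} {y : ℕ} (hy : r d + 1 = y) (h : y < 2 ^ W)
    (hQ : Q (Function.update r d y) false) : Computes W (.inc d) (routineCost W) r Q := by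
  subst hy
  intro s hs hr
  have hc : s.1 ∘ Sum.inr = r := funext hr
  refine Runs.mono_time (Runs.seq (Runs.flag (Runs.seq (Runs.op (Runs.seq (Runs.flag
    (Runs.op ?_))))))) (by unfold routineCost; omega)
  simpa [Op.eval, hc, hr, Nat.mod_eq_of_lt h, h.not_ge] using hQ

lemma Computes.add {d v : U} {y : ℕ} (hy : r d + r v = y) (h : y < 2 ^ W)
    (hQ : Q (Function.update r d y) false) : Computes W (.add d v) (routineCost W) r Q := by
  subst hy
  intro s hs hr
  have hc : s.1 ∘ Sum.inr = r := funext hr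
  refine Runs.mono_time (Runs.seq (Runs.flag (Runs.op ?_))) (by unfold routineCost; omega)
  simpa [Op.eval, hc, hr, Nat.mod_eq_of_lt h, h.not_ge] using hQ

lemma Computes.sub {d v : U} {y : ℕ} (hy : r d - r v = y) (h : r v ≤ r d)
    (hQ : Q (Function.update r d y) false) : Computes W (.sub d v) (routineCost W) r Q := by
  subst hy
  intro s hs hr
  have hc : s.1 ∘ Sum.inr = r := funext hr
  refine Runs.mono_time (Runs.seq (Runs.flag (Runs.op ?_))) (by unfold routineCost; omega)
  have hd : r d < 2 ^ W := hr d ▸ hs _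
  have e : (r d + 2 ^ W - r v) % 2 ^ W = r d - r v := by
    rw [show r d + 2 ^ W - r v = r d - r v + 2 ^ W by omega, Nat.add_mod_right,
      Nat.mod_eq_of_lt (by omega)]
  simpa [Op.eval, hc, hr, e, h.not_gt] using hQ

lemma Computes.copy {d v : U} {y : ℕ} (hy : r v = y) (hQ : ∀ f, Q (Function.update r d y) f) :
    Computes W (.copy d v) (routineCost W) r Q := by
  subst hy
  intro s hs hr
  have hc : s.1 ∘ Sum.inr = r := funext hr
  refine Runs.mono_time (Runs.op ?_) (by unfold routineCost; omega)
  simpa [Op.eval, hc, hr] using hQ _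

lemma Computes.lt {u v : U} {x y : ℕ} (hx : r u = x) (hy : r v = y) (hQ : Q r (decide (x < y))) :
    Computes W (.lt u v) (routineCost W) r Q := by
  subst hx hy
  intro s hs hr
  have hc : s.1 ∘ Sum.inr = r := funext hr
  refine Runs.mono_time (Runs.seq (Runs.flag (Runs.op ?_))) (by unfold routineCost; omega)
  simpa [Op.eval, hr] using hQ

lemma Computes.mul {d u v : U} {y : ℕ} (hW : 0 < W) (hy : r u * r v = y) (h : y < 2 ^ W)
    (hQ : ∀ f, Q (Function.update r d y) f) :
    Computes W (.mul d u v) (routineCost W) r Q := by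
  subst hy
  intro s hs hr
  have hc : s.1 ∘ Sum.inr = r := funext hr
  refine Runs.mono_time
    (m := 1 + (1 + (1 + (1 + ((W * ((1 + (1 + (1 + (1 + 1)))) + 6) + 4) + 1)))))
    (Runs.seq <| Runs.op <| Runs.seq <| Runs.op <| Runs.seq <| Runs.flag <| Runs.seq <|
      Runs.op <| Runs.seq <| Runs.scan (A := r u)
      (Inv := fun m g => g (.inl .p) = m * r v ∧ g (.inl .b) = r v ∧ ∀ u, g (.inr u) = r u)
      hW (by simp) ?_ ?_ ?_ ?_ ?_ ?_ ?_)
    (by unfold routineCost; omega)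
  · rintro m s ⟨h₁, h₂, h₃⟩ hm
    have hb : (2 * m + s.2.toNat) * r v < 2 ^ W := (Nat.mul_le_mul_right _ hm).trans_lt h
    have hp : m * r v + m * r v < 2 ^ W := by
      refine lt_of_le_of_lt ?_ hb
      rw [add_mul]; linarith [Nat.zero_le (s.2.toNat * r v)]
    refine Runs.ite (fun hf => ?_) (fun hf => ?_)
    · refine Runs.seq (Runs.flag (Runs.seq (Runs.op (Runs.seq (Runs.flag (Runs.op ?_))))))
      rw [hf] at hb
      have e : m * r v + m * r v + r v = (2 * m + 1) * r v := by ring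
      simp only [Bool.toNat_true] at hb
      simp [Op.eval, h₁, h₂, h₃, hf, Nat.mod_eq_of_lt hp, e, Nat.mod_eq_of_lt hb]
    · refine Runs.mono_time (Runs.seq (Runs.flag (Runs.op ?_))) (by omega)
      simp [Op.eval, h₁, h₂, h₃, hf, Nat.mod_eq_of_lt hp]
      ring
  · rintro m g x ⟨h₁, h₂, h₃⟩
    simp [h₁, h₂, h₃]
  · rintro m g x ⟨h₁, h₂, h₃⟩
    simp [h₁, h₂, h₃]
  · simp [Op.eval, hr]
  · exact hr u ▸ hs _
  · simp [Op.eval, hr]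
  · rintro s' ⟨h₁, -, h₃⟩
    have hc' : s'.1 ∘ Sum.inr = r := funext h₃
    refine Runs.op ?_
    simpa [Op.eval, hc', h₁] using hQ _

lemma Computes.divMod {d m u v : U} {y y' : ℕ} (hW : 0 < W) (hy : r u / r v = y)
    (hy' : r u % r v = y') (h₀ : 0 < r v) (h : 2 * r v ≤ 2 ^ W)
    (hQ : ∀ f, Q (Function.update (Function.update r d y) m y') f) :
    Computes W (.divMod d m u v) (routineCost W) r Q := by
  subst hy hy'
  intro s hs hr
  have hu : r u < 2 ^ W := hr u ▸ hs _
  have hc : s.1 ∘ Sum.inr = r := funext hr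
  refine Runs.mono_time
    (m := 1 + (1 + (1 + (1 + (1 + (1 + ((W * ((1 + (1 + (1 + (1 + (1 + (1 + (1 + 1))))))) + 6) + 4)
      + (1 + 1))))))))
    (Runs.seq <| Runs.op <| Runs.seq <| Runs.op <| Runs.seq <| Runs.flag <| Runs.seq <|
      Runs.op <| Runs.seq <| Runs.flag <| Runs.seq <| Runs.op <| Runs.seq <|
      Runs.scan (A := r u)
      (Inv := fun m g => g (.inl .q) = m / r v ∧ g (.inl .r) = m % r v ∧ g (.inl .b) = r v ∧
        ∀ u, g (.inr u) = r u)
      hW (by simp) ?_ ?_ ?_ ?_ ?_ ?_ ?_)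
    (by unfold routineCost; omega)
  · rintro m s ⟨h₁, h₂, h₃, h₄⟩ hm
    set β := s.2.toNat with hβ
    have hβ' : β < 2 := Bool.toNat_lt s.2
    have hlt := Nat.mod_lt m h₀
    have hr1 : m % r v + m % r v + β < 2 ^ W := by omega
    have hq0 : m / r v ≤ m := Nat.div_le_self _ _
    have hq1 : m / r v + m / r v < 2 ^ W := by omega
    have hdm := Nat.div_add_mod m (r v)
    have he : 2 * m + β = (m % r v + m % r v + β) + r v * (m / r v + m / r v) := by
      conv_lhs => rw [← hdm]
      ring
    refine Runs.seq (Runs.op (Runs.seq (Runs.flag (Runs.seq (Runs.op ?_)))))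
    refine Runs.ite (fun hf => ?_) (fun hf => ?_)
    · have hf' : m % r v + m % r v + β < r v := by
        simpa [Op.eval, h₂, h₃, ← hβ, Nat.mod_eq_of_lt hr1] using hf
      have e₁ : (2 * m + β) / r v = m / r v + m / r v := by
        rw [he, Nat.add_mul_div_left _ _ h₀, Nat.div_eq_of_lt hf', zero_add]
      have e₂ : (2 * m + β) % r v = m % r v + m % r v + β := by
        rw [he, Nat.add_mul_mod_self_left, Nat.mod_eq_of_lt hf']
      refine Runs.mono_time (Runs.seq (Runs.flag (Runs.op ?_))) (by omega)
      simp [Op.eval, h₁, h₂, h₃, h₄, ← hβ, Nat.mod_eq_of_lt hr1, Nat.mod_eq_of_lt hq1, e₁, e₂]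
    · have hf' : r v ≤ m % r v + m % r v + β := by
        simpa [Op.eval, h₂, h₃, ← hβ, Nat.mod_eq_of_lt hr1] using hf
      have he' : 2 * m + β = (m % r v + m % r v + β - r v) + r v * (m / r v + m / r v + 1) := by
        rw [he, mul_add (r v) _ 1]; omega
      have e₁ : (2 * m + β) / r v = m / r v + m / r v + 1 := by
        rw [he', Nat.add_mul_div_left _ _ h₀, Nat.div_eq_of_lt (by omega), zero_add]
      have e₂ : (2 * m + β) % r v = m % r v + m % r v + β - r v := by
        rw [he', Nat.add_mul_mod_self_left, Nat.mod_eq_of_lt (by omega)]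
      have hq2 : m / r v + m / r v + 1 < 2 ^ W := by
        rw [← e₁]
        exact ((Nat.div_le_self _ _).trans hm).trans_lt hu
      have hs2 : (m % r v + m % r v + β + 2 ^ W - r v) % 2 ^ W = m % r v + m % r v + β - r v := by
        rw [show m % r v + m % r v + β + 2 ^ W - r v = m % r v + m % r v + β - r v + 2 ^ W by omega,
          Nat.add_mod_right, Nat.mod_eq_of_lt (by omega)]
      refine Runs.mono_time
        (Runs.seq (Runs.flag (Runs.seq (Runs.op (Runs.seq (Runs.flag (Runs.op ?_)))))))
        (by omega)
      simp [Op.eval, h₁, h₂, h₃, h₄, ← hβ, Nat.mod_eq_of_lt hr1, Nat.mod_eq_of_lt hq2, e₁, e₂, hs2]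
  · rintro m g x ⟨h₁, h₂, h₃⟩
    simp [h₁, h₂, h₃]
  · rintro m g x ⟨h₁, h₂, h₃⟩
    simp [h₁, h₂, h₃]
  · simp [Op.eval, hr]
  · exact hr u ▸ hs _
  · simp [Op.eval, hr]
  · rintro s' ⟨h₁, h₂, -, h₃⟩
    have hc' : s'.1 ∘ Sum.inr = r := funext h₃
    refine Runs.seq (Runs.op (Runs.op ?_))
    simpa [Op.eval, h₁, h₂, hc'] using hQ _

/-- A routine followed by a program that consists of `n` routines. -/
lemma Computes.step {c d : Cmd (Scratch ⊕ U)} {n : ℕ}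
    (h : Computes W c (routineCost W) r fun r' _ => Computes W d (routineCost W * n) r' Q) :
    Computes W (.seq c d) (routineCost W * (n + 1)) r Q :=
  h.seq.mono_time (by rw [mul_add]; omega)

lemma Computes.last {c : Cmd (Scratch ⊕ U)} (h : Computes W c (routineCost W) r Q) :
    Computes W c (routineCost W * 1) r Q := by rwa [mul_one]

end Computes

/-! ### Sums of the integral parts of a linear function -/

/-- The sum of `⌊(a * i + o) / m⌋` over `i < n`. -/
def floorSum (n m a o : ℕ) : ℕ := ∑ i ∈ Finset.range n, (a * i + o) / m

lemma two_mul_floorSum_mod {m : ℕ} (hm : 0 < m) (n a o : ℕ) :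
    2 * floorSum n m a o =
      (n * n - n) * (a / m) + (n * (o / m) + n * (o / m)) +
        2 * floorSum n m (a % m) (o % m) := by
  have h : ∀ i, (a * i + o) / m = i * (a / m) + o / m + (a % m * i + o % m) / m := by
    intro i
    have e : a * i + o = (a % m * i + o % m) + m * (i * (a / m) + o / m) := by
      conv_lhs => rw [← Nat.div_add_mod a m, ← Nat.div_add_mod o m]
      ring
    rw [e, Nat.add_mul_div_left _ _ hm]
    omega
  have hs : (∑ i ∈ Finset.range n, i) * 2 = n * n - n := by
    rw [Finset.sum_range_id_mul_two, Nat.mul_sub, mul_one]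
  simp only [floorSum, h, Finset.sum_add_distrib, ← Finset.sum_mul, Finset.sum_const,
    Finset.card_range, smul_eq_mul]
  rw [← hs]
  ring

lemma floorSum_eq_zero {n m a o : ℕ} (h : a * n + o < m) : floorSum n m a o = 0 := by
  refine Finset.sum_eq_zero fun i hi => Nat.div_eq_of_lt (lt_of_le_of_lt ?_ h)
  have := (Finset.mem_range.1 hi).le
  gcongr

/-- The integral part of a quotient counts the multiples of the denominator. -/
lemma div_eq_card {m k y : ℕ} (hm : 0 < m) (hy : k / m ≤ y) :
    k / m = ((Finset.range y).filter fun j => m * (j + 1) ≤ k).card := by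
  have : ((Finset.range y).filter fun j => m * (j + 1) ≤ k) = Finset.range (k / m) := by
    ext j
    simp only [Finset.mem_filter, Finset.mem_range]
    rw [mul_comm, ← Nat.le_div_iff_mul_le hm]
    omega
  rw [this, Finset.card_range]

/-- Reciprocity: a sum over the lattice points below a line is a sum over the lattice points on the
other side of the diagonal of a rectangle, with the rôles of the coordinates exchanged. -/
lemma floorSum_reciprocity {n m a o : ℕ} (ham : a < m) (hom : o < m) (hle : m ≤ a * n + o) :
    floorSum n m a o = floorSum ((a * n + o) / m) a m ((a * n + o) % m) := by
  have hm : 0 < m := by omega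
  have ha : 0 < a := by
    rcases Nat.eq_zero_or_pos a with rfl | h
    · omega
    · exact h
  set y := (a * n + o) / m with hy
  set ρ := (a * n + o) % m with hρ
  have hyρ : m * y + ρ = a * n + o := Nat.div_add_mod _ _
  have hρm : ρ < m := Nat.mod_lt _ hm
  have h₁ : floorSum n m a o = ∑ i ∈ Finset.range n, ∑ j ∈ Finset.range y,
      if m * (j + 1) ≤ a * i + o then 1 else 0 := by
    refine Finset.sum_congr rfl fun i hi => ?_
    rw [div_eq_card hm (y := y), Finset.card_filter]
    refine Nat.div_le_div_right ?_
    have := (Finset.mem_range.1 hi).le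
    gcongr
  have h₂ : floorSum y a m ρ = ∑ j ∈ Finset.range y, ∑ i ∈ Finset.range n,
      if a * (i + 1) ≤ m * j + ρ then 1 else 0 := by
    refine Finset.sum_congr rfl fun j hj => ?_
    rw [div_eq_card ha (y := n), Finset.card_filter]
    have hj := Finset.mem_range.1 hj
    have : m * (j + 1) ≤ m * y := Nat.mul_le_mul_left _ hj
    rw [mul_add] at this
    refine Nat.le_of_lt_succ ((Nat.div_lt_iff_lt_mul ha).2 ?_)
    rw [Nat.succ_mul, mul_comm n a]
    omega
  rw [h₁, h₂, Finset.sum_comm, ← Finset.sum_range_reflect]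
  refine Finset.sum_congr rfl fun j hj => ?_
  rw [← Finset.sum_range_reflect]
  refine Finset.sum_congr rfl fun i hi => ?_
  have hj := Finset.mem_range.1 hj
  have hi := Finset.mem_range.1 hi
  obtain ⟨j', hj'⟩ : ∃ j', y = j + 1 + j' := ⟨y - 1 - j, by omega⟩
  obtain ⟨i', hi'⟩ : ∃ i', n = i + 1 + i' := ⟨n - 1 - i, by omega⟩
  rw [show y - 1 - j = j' by omega, show n - 1 - i = i' by omega]
  refine if_congr ?_ rfl rfl
  rw [hj', hi'] at hyρ
  constructor <;> intro h <;> nlinarith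

lemma floorSum_quotient_le {n m a o : ℕ} (ham : a < m) (hom : o < m) : (a * n + o) / m ≤ n := by
  refine Nat.le_of_lt_succ ((Nat.div_lt_iff_lt_mul (by omega)).2 ?_)
  rw [Nat.succ_mul]
  nlinarith

/-- The product that controls the number of rounds is halved in each round. -/
lemma mul_mod_lt_of_lt {m a k : ℕ} (ha : 0 < a) (ham : a < m) (h : m * a < 2 ^ (k + 1)) :
    a * (m % a) < 2 ^ k := by
  have h₁ := Nat.div_add_mod m a
  have h₂ := Nat.mod_lt m ha
  have h₃ : 1 ≤ m / a := (Nat.one_le_div_iff ha).2 ham.le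
  have h₄ : 2 * (m % a) < m := by nlinarith
  rw [pow_succ] at h
  nlinarith

/-! ### The program for sums of integral parts -/

/-- The user registers: the input `x`, the length `l` of the blocks, the number `n` of summands that
are already contained, twice, in `acc`, the data `i = n + 1`, `b = n + l`, `sq = b ^ 2`, `e` (the
allowed error), `xb = x * b` and `lo` (the lower bound) of the current block, the arguments `fn`,
`fm`, `fa`, `fo` and the result `ans` of the program for sums of integral parts, and two temporary
registers. -/
inductive Reg
  | x
  | n
  | l
  | acc
  | i
  | b
  | sq
  | e
  | xb
  | lo
  | fn
  | fm
  | fa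
  | fo
  | ans
  | t
  | u
  deriving DecidableEq

instance : Fintype Reg :=
  ⟨{.x, .n, .l, .acc, .i, .b, .sq, .e, .xb, .lo, .fn, .fm, .fa, .fo, .ans, .t, .u},
    fun k => by cases k <;> simp⟩

/-- The registers that the program for sums of integral parts may change. -/
def Reg.isFloorSum : Reg → Bool
  | .fn | .fm | .fa | .fo | .ans | .t | .u => true
  | _ => false

/-- The reduction of the slope and of the offset modulo the denominator, and the test whether the
remaining sum vanishes. -/
def floorSumReduce : Cmd (Scratch ⊕ Reg) :=
  .seq (.divMod .t .fa .fa .fm) <| .seq (.mul .u .fn .fn) <| .seq (.sub .u .fn) <|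
  .seq (.mul .u .u .t) <| .seq (.add .ans .u) <| .seq (.divMod .t .fo .fo .fm) <|
  .seq (.mul .u .fn .t) <| .seq (.add .ans .u) <| .seq (.add .ans .u) <|
  .seq (.mul .u .fa .fn) <| .seq (.add .u .fo) <| .lt .u .fm

/-- The exchange of the coordinates. -/
def floorSumFlip : Cmd (Scratch ⊕ Reg) :=
  .seq (.divMod .fn .fo .u .fm) <| .seq (.copy .t .fm) <| .seq (.copy .fm .fa) <| .copy .fa .t

/-- A Euclidean algorithm that sets `ans` to twice the sum of `⌊(fa * i + fo) / fm⌋` over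
`i < fn`. The factor two makes it unnecessary to halve the triangular numbers that occur. -/
def floorSumProgram : Cmd (Scratch ⊕ Reg) :=
  .seq (.zero .ans) (.loop floorSumReduce floorSumFlip)

variable {W : ℕ} {r : Reg → ℕ} {Q : (Reg → ℕ) → Bool → Prop}

lemma computes_floorSumReduce (hW : 0 < W) {n m a o s B : ℕ} (hn : r .fn = n) (hm : r .fm = m)
    (ha : r .fa = a) (ho : r .fo = o) (hs : r .ans = s) (hm0 : 0 < m) (hnB : n ≤ B) (hmB : m ≤ B)
    (haB : a ≤ B) (hoB : o ≤ B) (hB : 2 * B ^ 3 < 2 ^ W)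
    (hsum : s + 2 * floorSum n m a o < 2 ^ W)
    (hQ : ∀ r', (∀ v, v.isFloorSum = false → r' v = r v) → r' .fn = n → r' .fm = m →
      r' .fa = a % m → r' .fo = o % m → r' .u = a % m * n + o % m →
      r' .ans + 2 * floorSum n m (a % m) (o % m) = s + 2 * floorSum n m a o →
      Q r' (decide (a % m * n + o % m < m))) :
    Computes W floorSumReduce (routineCost W * 12) r Q := by
  have hB1 : 1 ≤ B := hm0.trans_le hmB
  have hB2 : B ≤ B ^ 3 := Nat.le_self_pow (by norm_num) B
  have hB3 : B * B ≤ B ^ 3 := by nlinarith [Nat.mul_le_mul_left (B * B) hB1]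
  have hB0 : 0 < B ^ 3 := by positivity
  have hsplit := two_mul_floorSum_mod hm0 n a o
  have h2m : 2 * m ≤ 2 ^ W := by omega
  have hnn : n * n ≤ B * B := Nat.mul_le_mul hnB hnB
  have hnt : n * (o / m) ≤ B * B := Nat.mul_le_mul hnB ((Nat.div_le_self _ _).trans hoB)
  have han : a % m * n ≤ B * B := Nat.mul_le_mul ((Nat.mod_le _ _).trans haB) hnB
  have hom : o % m ≤ B := (Nat.mod_le _ _).trans hoB
  have hnat : (n * n - n) * (a / m) ≤ B ^ 3 := by
    calc _ ≤ (B * B) * B := Nat.mul_le_mul ((Nat.sub_le _ _).trans hnn)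
          ((Nat.div_le_self _ _).trans haB)
      _ = B ^ 3 := by ring
  obtain ⟨p₁, hp₁⟩ : ∃ p, (n * n - n) * (a / m) = p := ⟨_, rfl⟩
  obtain ⟨p₂, hp₂⟩ : ∃ p, n * (o / m) = p := ⟨_, rfl⟩
  obtain ⟨p₃, hp₃⟩ : ∃ p, a % m * n = p := ⟨_, rfl⟩
  rw [hp₁] at hnat hsplit
  rw [hp₂] at hnt hsplit
  rw [hp₃] at han hQ
  refine Computes.step (n := 11) (Computes.divMod (y := a / m) (y' := a % m) hW
    (by simp [ha, hm]) (by simp [ha, hm]) (by simp [hm, hm0]) (by simp [hm, h2m]) fun _ => ?_)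
  refine Computes.step (n := 10) (Computes.mul (y := n * n) hW (by simp [hn]) (by omega)
    fun _ => ?_)
  refine Computes.step (n := 9) (Computes.sub (y := n * n - n) (by simp [hn])
    (by simp [hn]; exact Nat.le_mul_self n) ?_)
  refine Computes.step (n := 8) (Computes.mul (y := p₁) hW (by simp [hp₁])
    (by omega) fun _ => ?_)
  refine Computes.step (n := 7) (Computes.add (y := s + p₁) (by simp [hs])
    (by omega) ?_)
  refine Computes.step (n := 6) (Computes.divMod (y := o / m) (y' := o % m) hW
    (by simp [ho, hm]) (by simp [ho, hm]) (by simp [hm, hm0]) (by simp [hm, h2m]) fun _ => ?_)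
  refine Computes.step (n := 5) (Computes.mul (y := p₂) hW (by simp [hp₂, hn]) (by omega)
    fun _ => ?_)
  refine Computes.step (n := 4) (Computes.add
    (y := s + p₁ + p₂) (by simp) (by omega) ?_)
  refine Computes.step (n := 3) (Computes.add
    (y := s + p₁ + p₂ + p₂) (by simp) (by omega) ?_)
  refine Computes.step (n := 2) (Computes.mul (y := p₃) hW (by simp [hp₃, hn]) (by omega)
    fun _ => ?_)
  refine Computes.step (n := 1) (Computes.add (y := p₃ + o % m) (by simp) (by omega) ?_)
  refine Computes.last (Computes.lt (x := p₃ + o % m) (y := m) (by simp) (by simp [hm])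
    (hQ _ ?_ ?_ ?_ ?_ ?_ ?_ ?_))
  · intro v hv
    cases v <;> first | (cases hv; done) | simp
  · simp [hn]
  · simp [hm]
  · simp
  · simp
  · simp
  · simp only [Function.update_self, ne_eq, reduceCtorEq, not_false_eq_true, Function.update_of_ne]
    omega

lemma computes_floorSumFlip (hW : 0 < W) {m a y : ℕ} (hm : r .fm = m)
    (ha : r .fa = a) (hy : r .u = y) (hm0 : 0 < m) (hmW : 2 * m ≤ 2 ^ W)
    (hQ : ∀ r' f, (∀ v, v.isFloorSum = false → r' v = r v) → r' .fn = y / m → r' .fm = a →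
      r' .fa = m → r' .fo = y % m → r' .ans = r .ans → Q r' f) :
    Computes W floorSumFlip (routineCost W * 4) r Q := by
  refine Computes.step (n := 3) (Computes.divMod (y := y / m) (y' := y % m) hW
    (by simp [hy, hm]) (by simp [hy, hm]) (by simp [hm, hm0]) (by simp [hm, hmW]) fun _ => ?_)
  refine Computes.step (n := 2) (Computes.copy (y := m) (by simp [hm]) fun _ => ?_)
  refine Computes.step (n := 1) (Computes.copy (y := a) (by simp [ha]) fun _ => ?_)
  refine Computes.last (Computes.copy (y := m) (by simp) fun _ => hQ _ _ ?_ ?_ ?_ ?_ ?_ ?_)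
  · intro v hv
    cases v <;> first | (cases hv; done) | simp
  all_goals simp

lemma computes_floorSum_loop (hW : 0 < W) {B : ℕ} (hB : 2 * B ^ 3 < 2 ^ W) (k : ℕ)
    {n m a o s : ℕ} {r : Reg → ℕ} (hn : r .fn = n) (hm : r .fm = m)
    (ha : r .fa = a) (ho : r .fo = o) (hs : r .ans = s) (hm0 : 0 < m) (hnB : n ≤ B) (hmB : m ≤ B)
    (haB : a ≤ B) (hoB : o ≤ B) (hk : m * (a % m) < 2 ^ k)
    (hsum : s + 2 * floorSum n m a o < 2 ^ W)
    (hQ : ∀ r', (∀ v, v.isFloorSum = false → r' v = r v) →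
      r' .ans = s + 2 * floorSum n m a o → Q r' true) :
    Computes W (.loop floorSumReduce floorSumFlip) (routineCost W * (17 * (k + 1))) r Q := by
  induction k generalizing n m a o s r with
  | zero =>
    refine Computes.mono_time (Computes.loop (n := 0) (k := 0) (computes_floorSumReduce hW hn hm ha
      ho hs hm0 hnB hmB haB hoB hB hsum fun r' h₁ h₂ h₃ h₄ h₅ h₆ h₇ => ?_))
      (by unfold routineCost; omega)
    have h0 : a % m = 0 := by
      rcases Nat.eq_zero_or_pos (a % m) with h | h
      · exact h
      · have := Nat.mul_pos hm0 h
        omega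
    have hlt : a % m * n + o % m < m := by
      rw [h0]; simpa using Nat.mod_lt o hm0
    refine ⟨fun _ => hQ r' h₁ ?_, fun h => absurd hlt (by simpa using h)⟩
    rw [floorSum_eq_zero hlt] at h₇
    exact h₇
  | succ k ih =>
    refine Computes.mono_time (Computes.loop (n := routineCost W * 4)
      (k := routineCost W * (17 * (k + 1))) (computes_floorSumReduce hW hn hm ha
      ho hs hm0 hnB hmB haB hoB hB hsum fun r' h₁ h₂ h₃ h₄ h₅ h₆ h₇ => ?_))
      (by
        have : 1 ≤ routineCost W := by unfold routineCost; omega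
        nlinarith)
    refine ⟨fun h => hQ r' h₁ ?_, fun h => ?_⟩
    · rw [floorSum_eq_zero (by simpa using h)] at h₇
      exact h₇
    · have hge : m ≤ a % m * n + o % m := by simpa using h
      have hom : o % m < m := Nat.mod_lt _ hm0
      have ham : a % m < m := Nat.mod_lt _ hm0
      have ha0 : 0 < a % m := by
        rcases Nat.eq_zero_or_pos (a % m) with h | h
        · rw [h] at hge; omega
        · exact h
      have hBpow : B ≤ B ^ 3 := Nat.le_self_pow (by norm_num) B
      refine computes_floorSumFlip hW h₃ h₄ h₆ hm0 (by omega)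
        fun r₂ f g₁ g₂ g₃ g₄ g₅ g₆ => ?_
      have hrec := floorSum_reciprocity ham hom hge
      refine ih g₂ g₃ g₄ g₅ (g₆.trans rfl) ha0
        ((floorSum_quotient_le ham hom).trans hnB) (ham.le.trans hmB) hmB
        ((Nat.mod_lt _ hm0).le.trans hmB) (mul_mod_lt_of_lt ha0 ham hk) ?_ fun r₃ e₁ e₂ => ?_
      · rw [← hrec]; omega
      · refine hQ r₃ (fun v hv => by rw [e₁ v hv, g₁ v hv, h₁ v hv]) ?_
        rw [e₂, ← hrec, h₇]

/-- The number of instructions for a sum of integral parts, at most. -/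
def floorSumCost (W : ℕ) : ℕ := routineCost W * (17 * W + 18)

lemma computes_floorSum (hW : 0 < W) {n m a o B : ℕ} (hB : 2 * B ^ 3 < 2 ^ W)
    (hn : r .fn = n) (hm : r .fm = m) (ha : r .fa = a) (ho : r .fo = o)
    (hm0 : 0 < m) (hnB : n ≤ B) (hmB : m ≤ B)
    (haB : a ≤ B) (hoB : o ≤ B) (hsum : 2 * floorSum n m a o < 2 ^ W)
    (hQ : ∀ r', (∀ v, v.isFloorSum = false → r' v = r v) →
      r' .ans = 2 * floorSum n m a o → Q r' true) :
    Computes W floorSumProgram (floorSumCost W) r Q := by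
  refine Computes.mono_time (Computes.seq (Computes.zero (computes_floorSum_loop (n := n) (m := m)
    (a := a) (o := o) (s := 0) hW hB W
    (by simp [hn]) (by simp [hm]) (by simp [ha]) (by simp [ho]) (by simp) hm0 hnB hmB haB hoB ?_
    (by simpa using hsum) fun r' h₁ h₂ => hQ r' (fun v hv => ?_) (by simpa using h₂))))
    (by unfold floorSumCost; nlinarith)
  · have h1 : m * (a % m) ≤ B * B := Nat.mul_le_mul hmB ((Nat.mod_le _ _).trans haB)
    have h2 : 1 ≤ B := hm0.trans_le hmB
    have h3 : B * B ≤ B ^ 3 := by nlinarith [Nat.mul_le_mul_left (B * B) h2]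
    have h4 : 0 < B ^ 3 := by positivity
    omega
  · rw [h₁ v hv]
    cases v <;> first | (cases hv; done) | simp

/-! ### Blocks of consecutive divisors -/

/-- The sum of `⌊x / i⌋` over `1 ≤ i ≤ n`. -/
def quotientSum (x n : ℕ) : ℕ := ∑ i ∈ Finset.range n, x / (i + 1)

/-- The error allowed for in the approximation of `x / i` by a linear function of `i`, for `i` in
the block that consists of the `L` numbers after `n`. It is relative to the denominator
`(n + L) ^ 2`. -/
def blockError (x L n : ℕ) : ℕ := L * L * x / (n + 1)

/-- The sum of the integral parts of the tangent of `t ↦ x / t` at `n + L`, over the `L` numbers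
after `n`. -/
def blockLower (x L n : ℕ) : ℕ := floorSum L ((n + L) * (n + L)) x (x * (n + L))

/-- The sum of the integral parts of an upper bound for `t ↦ x / t` that is parallel to the tangent
at `n + L`, over the `L` numbers after `n`. -/
def blockUpper (x L n : ℕ) : ℕ :=
  floorSum L ((n + L) * (n + L)) x (x * (n + L) + blockError x L n)

/-- A block is good if it lies below the square root of `x` and if the two linear bounds agree. -/
def GoodBlock (x L n : ℕ) : Prop :=
  (n + L) * (n + L) ≤ x ∧ blockUpper x L n ≤ blockLower x L n

instance (x L n : ℕ) : Decidable (GoodBlock x L n) := by unfold GoodBlock; infer_instance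

lemma tangent_div_le {x b h : ℕ} (hb : h < b) : (x * h + x * b) / (b * b) ≤ x / (b - h) := by
  obtain ⟨d, rfl⟩ : ∃ d, b = d + h := ⟨b - h, by omega⟩
  rw [Nat.add_sub_cancel, Nat.le_div_iff_mul_le (by omega)]
  have h₁ := Nat.div_mul_le_self (x * h + x * (d + h)) ((d + h) * (d + h))
  set q := (x * h + x * (d + h)) / ((d + h) * (d + h))
  have h₂ : q * d * ((d + h) * (d + h)) ≤ x * ((d + h) * (d + h)) := by
    calc q * d * ((d + h) * (d + h)) = q * ((d + h) * (d + h)) * d := by ring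
      _ ≤ (x * h + x * (d + h)) * d := by gcongr
      _ ≤ x * ((d + h) * (d + h)) := by nlinarith [Nat.zero_le (x * h * h)]
  exact Nat.le_of_mul_le_mul_right h₂ (Nat.mul_pos (by omega) (by omega))

lemma div_le_tangent {x L n h : ℕ} (hh : h < L) :
    x / (n + L - h) ≤
      (x * h + (x * (n + L) + blockError x L n)) / ((n + L) * (n + L)) := by
  obtain ⟨d, hd⟩ : ∃ d, n + L = d + h := ⟨n + L - h, by omega⟩
  have hd' : n + 1 ≤ d := by omega
  rw [hd, Nat.add_sub_cancel, Nat.le_div_iff_mul_le (Nat.mul_pos (by omega) (by omega))]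
  have h₁ := Nat.div_mul_le_self x d
  set q := x / d
  have h₂ : q * (h * h) ≤ blockError x L n := by
    rw [blockError, Nat.le_div_iff_mul_le (by omega)]
    calc q * (h * h) * (n + 1) ≤ q * (L * L) * d := by gcongr
      _ = L * L * (q * d) := by ring
      _ ≤ L * L * x := by gcongr
  nlinarith [Nat.mul_le_mul_right (d + h + h) h₁]

lemma quotientSum_add (x L n : ℕ) :
    quotientSum x (n + L) = quotientSum x n + ∑ h ∈ Finset.range L, x / (n + L - h) := by
  rw [quotientSum, Finset.sum_range_add, quotientSum]
  congr 1
  rw [← Finset.sum_range_reflect]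
  refine Finset.sum_congr rfl fun h hh => ?_
  have := Finset.mem_range.1 hh
  congr 1
  omega

lemma blockLower_le (x L n : ℕ) :
    blockLower x L n ≤ ∑ h ∈ Finset.range L, x / (n + L - h) := by
  unfold blockLower floorSum
  refine Finset.sum_le_sum fun h hh => tangent_div_le ?_
  have := Finset.mem_range.1 hh
  omega

lemma le_blockUpper (x L n : ℕ) :
    ∑ h ∈ Finset.range L, x / (n + L - h) ≤ blockUpper x L n :=
  Finset.sum_le_sum fun _ hh => div_le_tangent (Finset.mem_range.1 hh)

lemma GoodBlock.quotientSum_add {x L n : ℕ} (h : GoodBlock x L n) :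
    quotientSum x (n + L) = quotientSum x n + blockUpper x L n := by
  rw [DivisorSummatory.quotientSum_add]
  have h₁ := blockLower_le x L n
  have h₂ := le_blockUpper x L n
  have h₃ := h.2
  omega

lemma quotientSum_le (x n : ℕ) : quotientSum x n ≤ n * x := by
  calc quotientSum x n ≤ ∑ _i ∈ Finset.range n, x :=
        Finset.sum_le_sum fun i _ => Nat.div_le_self _ _
    _ = n * x := by simp

/-- The number of rounds that the algorithm needs from the number `n` on. -/
def rounds (x L n : ℕ) : ℕ :=
  (Nat.sqrt x - n) / L + ((Finset.Ico n (Nat.sqrt x)).filter fun j => ¬GoodBlock x L j).card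

lemma GoodBlock.le_sqrt {x L n : ℕ} (h : GoodBlock x L n) : n + L ≤ Nat.sqrt x :=
  Nat.le_sqrt.2 h.1

lemma rounds_of_good {x L n : ℕ} (hL : 0 < L) (h : GoodBlock x L n) :
    rounds x L (n + L) + 1 ≤ rounds x L n := by
  have h₁ := h.le_sqrt
  have h₂ : (Nat.sqrt x - n) / L = (Nat.sqrt x - (n + L)) / L + 1 := by
    rw [← Nat.add_div_right _ hL]
    congr 1
    omega
  have h₃ : ((Finset.Ico (n + L) (Nat.sqrt x)).filter fun j => ¬GoodBlock x L j).card ≤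
      ((Finset.Ico n (Nat.sqrt x)).filter fun j => ¬GoodBlock x L j).card :=
    Finset.card_le_card (Finset.filter_subset_filter _ (Finset.Ico_subset_Ico_left (by omega)))
  unfold rounds
  omega

lemma rounds_of_not_good {x L n : ℕ} (hn : n < Nat.sqrt x) (h : ¬GoodBlock x L n) :
    rounds x L (n + 1) + 1 ≤ rounds x L n := by
  have h₂ : (Nat.sqrt x - (n + 1)) / L ≤ (Nat.sqrt x - n) / L :=
    Nat.div_le_div_right (by omega)
  have h₃ : ((Finset.Ico n (Nat.sqrt x)).filter fun j => ¬GoodBlock x L j).card =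
      ((Finset.Ico (n + 1) (Nat.sqrt x)).filter fun j => ¬GoodBlock x L j).card + 1 := by
    rw [← Finset.insert_Ico_add_one_left_eq_Ico hn, Finset.filter_insert, if_pos h,
      Finset.card_insert_of_notMem (by simp)]
  unfold rounds
  omega

/-! ### The hyperbola method -/

lemma divisorSum_eq (x : ℕ) : divisorSum x = ∑ n ∈ Finset.Ioc 0 x, x / n := by
  rw [← ArithmeticFunction.sum_Ioc_sigma0_eq_sum_div, divisorSum]
  simp only [ArithmeticFunction.sigma_zero_apply]
  rfl

/-- Dirichlet's hyperbola method: of the pairs with product at most `x`, those with a component at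
most `√x` are counted twice, up to the square of pairs in which both components are. -/
lemma divisorSum_add_sq (x : ℕ) :
    divisorSum x + Nat.sqrt x * Nat.sqrt x = 2 * quotientSum x (Nat.sqrt x) := by
  set s := Nat.sqrt x with hs
  have hsx : s ≤ x := Nat.sqrt_le_self x
  have hss : s * s ≤ x := Nat.sqrt_le x
  have hss' : x < (s + 1) * (s + 1) := Nat.lt_succ_sqrt x
  have hq : quotientSum x s = ∑ n ∈ Finset.Ioc 0 s, x / n := by
    rw [quotientSum, Finset.range_eq_Ico, Finset.sum_Ico_add' (fun n => x / n) 0 s 1]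
    rfl
  have hsplit : ∑ n ∈ Finset.Ioc 0 x, x / n =
      ∑ n ∈ Finset.Ioc 0 s, x / n + ∑ n ∈ Finset.Ioc s x, x / n :=
    (Finset.sum_Ioc_consecutive _ (Nat.zero_le s) hsx).symm
  have h₁ : ∑ n ∈ Finset.Ioc s x, x / n =
      ∑ n ∈ Finset.Ioc s x, ∑ k ∈ Finset.Ioc 0 s, if n * k ≤ x then 1 else 0 := by
    refine Finset.sum_congr rfl fun n hn => ?_
    have hn := Finset.mem_Ioc.1 hn
    have hle : x / n ≤ s := by
      refine Nat.le_of_lt_succ ((Nat.div_lt_iff_lt_mul (by omega)).2 (hss'.trans_le ?_))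
      exact Nat.mul_le_mul_left _ hn.1
    rw [← Finset.card_filter]
    have : (Finset.Ioc 0 s).filter (fun k => n * k ≤ x) = Finset.Ioc 0 (x / n) := by
      ext k
      simp only [Finset.mem_filter, Finset.mem_Ioc]
      rw [mul_comm, ← Nat.le_div_iff_mul_le (by omega)]
      omega
    rw [this, Nat.card_Ioc, Nat.sub_zero]
  have h₂ : ∀ k ∈ Finset.Ioc 0 s, (∑ n ∈ Finset.Ioc s x, if n * k ≤ x then 1 else 0) + s =
      x / k := by
    intro k hk
    have hk := Finset.mem_Ioc.1 hk
    have hle : s ≤ x / k := by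
      rw [Nat.le_div_iff_mul_le (by omega)]
      exact (Nat.mul_le_mul_left s hk.2).trans hss
    rw [← Finset.card_filter]
    have : (Finset.Ioc s x).filter (fun n => n * k ≤ x) = Finset.Ioc s (x / k) := by
      ext n
      simp only [Finset.mem_filter, Finset.mem_Ioc]
      rw [← Nat.le_div_iff_mul_le (by omega)]
      have := Nat.div_le_self x k
      omega
    rw [this, Nat.card_Ioc]
    omega
  have h₃ : ∑ n ∈ Finset.Ioc s x, x / n + s * s = ∑ k ∈ Finset.Ioc 0 s, x / k := by
    rw [h₁, Finset.sum_comm, ← Finset.sum_congr rfl h₂, Finset.sum_add_distrib]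
    simp
  rw [divisorSum_eq, hsplit, hq]
  omega

/-! ### The program for the divisor sum -/

/-- The length of the blocks: the integral part of the 64th root of `x`, or `1` if `x = 0`. -/
def blockLength (x : ℕ) : ℕ := max 1 (Nat.findGreatest (fun L => L ^ 64 ≤ x) x)

lemma blockLength_pos (x : ℕ) : 1 ≤ blockLength x := le_max_left _ _

lemma blockLength_pow_le {x : ℕ} (hx : 0 < x) : blockLength x ^ 64 ≤ x := by
  have h : Nat.findGreatest (fun L => L ^ 64 ≤ x) x ^ 64 ≤ x :=
    Nat.findGreatest_spec (P := fun L => L ^ 64 ≤ x) (m := 1) (by omega)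
      (by rw [one_pow]; exact hx)
  rcases max_choice 1 (Nat.findGreatest (fun L => L ^ 64 ≤ x) x) with e | e
  · rw [blockLength, e, one_pow]; exact hx
  · rwa [blockLength, e]

lemma lt_blockLength_succ_pow (x : ℕ) : x < (blockLength x + 1) ^ 64 := by
  by_contra! h
  have h1 : blockLength x + 1 ≤ x := (Nat.le_self_pow (by norm_num) _).trans h
  have := Nat.le_findGreatest (P := fun L => L ^ 64 ≤ x) h1 h
  have := le_max_right 1 (Nat.findGreatest (fun L => L ^ 64 ≤ x) x)
  unfold blockLength at *
  omega

lemma blockLength_le (x : ℕ) : blockLength x ≤ x + 1 := by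
  rcases Nat.eq_zero_or_pos x with rfl | hx
  · simp [blockLength]
  · exact ((Nat.le_self_pow (by norm_num) _).trans (blockLength_pow_le hx)).trans (by omega)

/-- The test whether the 64th power of `l + 1` exceeds `x`. -/
def lengthTest : Cmd (Scratch ⊕ Reg) :=
  .seq (.copy .t .l) <| .seq (.inc .t) <| .seq (.mul .t .t .t) <| .seq (.mul .t .t .t) <|
  .seq (.mul .t .t .t) <| .seq (.mul .t .t .t) <| .seq (.mul .t .t .t) <|
  .seq (.mul .t .t .t) <| .lt .x .t

/-- The computation of the length of the blocks. -/
def lengthProgram : Cmd (Scratch ⊕ Reg) := .seq (.inc .l) (.loop lengthTest (.inc .l))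

/-- The test whether the square of `n + 1` exceeds `x`. -/
def endTest : Cmd (Scratch ⊕ Reg) :=
  .seq (.copy .i .n) <| .seq (.inc .i) <| .seq (.mul .t .i .i) <| .lt .x .t

/-- The test whether the block after `n` extends beyond the square root of `x`. -/
def blockEndTest : Cmd (Scratch ⊕ Reg) :=
  .seq (.copy .b .n) <| .seq (.add .b .l) <| .seq (.mul .sq .b .b) <| .lt .x .sq

/-- The computation of the linear bounds for the block after `n`. -/
def blockPrepare : Cmd (Scratch ⊕ Reg) :=
  .seq (.mul .e .l .l) <| .seq (.mul .e .e .x) <| .seq (.divMod .e .t .e .i) <|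
  .seq (.mul .xb .x .b) <| .seq (.copy .fn .l) <| .seq (.copy .fm .sq) <| .seq (.copy .fa .x) <|
  .copy .fo .xb

/-- The preparation of the second sum of integral parts for the block after `n`. -/
def blockPrepareUpper : Cmd (Scratch ⊕ Reg) :=
  .seq (.copy .lo .ans) <| .seq (.copy .fn .l) <| .seq (.copy .fm .sq) <| .seq (.copy .fa .x) <|
  .seq (.copy .fo .xb) <| .add .fo .e

/-- The test whether the linear bounds for the block after `n` disagree. -/
def blockTest : Cmd (Scratch ⊕ Reg) :=
  .seq blockPrepare <| .seq floorSumProgram <| .seq blockPrepareUpper <| .seq floorSumProgram <|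
  .lt .lo .ans

/-- A step over a single number. -/
def singleStep : Cmd (Scratch ⊕ Reg) :=
  .seq (.copy .n .i) <| .seq (.divMod .u .t .x .i) <| .seq (.add .acc .u) <| .add .acc .u

/-- A step over a whole block. -/
def blockStep : Cmd (Scratch ⊕ Reg) := .seq (.add .acc .ans) (.copy .n .b)

/-- The main loop. -/
def mainLoop : Cmd (Scratch ⊕ Reg) :=
  .loop endTest (.branch blockEndTest singleStep (.branch blockTest singleStep blockStep))

/-- The program for the divisor sum, from `x` to `acc`. -/
def divisorSumProgram : Cmd (Scratch ⊕ Reg) :=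
  .seq lengthProgram <| .seq mainLoop <| .seq (.mul .t .n .n) (.sub .acc .t)

/-- The relevant registers in the course of the algorithm: all `i ≤ n` have been dealt with. -/
structure Progress (x n : ℕ) (r : Reg → ℕ) : Prop where
  x_eq : r .x = x
  l_eq : r .l = blockLength x
  n_eq : r .n = n
  acc_eq : r .acc = 2 * quotientSum x n

variable {W : ℕ} {r : Reg → ℕ} {Q : (Reg → ℕ) → Bool → Prop}

lemma computes_lengthTest (hW : 0 < W) {x l : ℕ} (hx : r .x = x) (hl : r .l = l)
    (h : (l + 1) ^ 64 < 2 ^ W)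
    (hQ : ∀ r', r' .x = x → r' .l = l → r' .n = r .n → r' .acc = r .acc →
      Q r' (decide (x < (l + 1) ^ 64))) :
    Computes W lengthTest (routineCost W * 9) r Q := by
  have hp : ∀ k ≤ 64, (l + 1) ^ k < 2 ^ W := fun k hk =>
    (Nat.pow_le_pow_right (by omega) hk).trans_lt h
  refine Computes.step (n := 8) (Computes.copy (y := l) hl fun _ => ?_)
  refine Computes.step (n := 7) (Computes.inc (y := (l + 1) ^ 1) (by simp) (hp 1 (by norm_num)) ?_)
  refine Computes.step (n := 6) (Computes.mul (y := (l + 1) ^ 2) hW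
    (by simp only [Function.update_self]; ring) (hp 2 (by norm_num)) fun _ => ?_)
  refine Computes.step (n := 5) (Computes.mul (y := (l + 1) ^ 4) hW
    (by simp only [Function.update_self]; ring) (hp 4 (by norm_num)) fun _ => ?_)
  refine Computes.step (n := 4) (Computes.mul (y := (l + 1) ^ 8) hW
    (by simp only [Function.update_self]; ring) (hp 8 (by norm_num)) fun _ => ?_)
  refine Computes.step (n := 3) (Computes.mul (y := (l + 1) ^ 16) hW
    (by simp only [Function.update_self]; ring) (hp 16 (by norm_num)) fun _ => ?_)
  refine Computes.step (n := 2) (Computes.mul (y := (l + 1) ^ 32) hW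
    (by simp only [Function.update_self]; ring) (hp 32 (by norm_num)) fun _ => ?_)
  refine Computes.step (n := 1) (Computes.mul (y := (l + 1) ^ 64) hW
    (by simp only [Function.update_self]; ring) (hp 64 (by norm_num)) fun _ => ?_)
  refine Computes.last (Computes.lt (x := x) (y := (l + 1) ^ 64) (by simp [hx]) (by simp)
    (hQ _ ?_ ?_ ?_ ?_))
  all_goals simp [hx, hl]

lemma pow_lt_of_le_blockLength {x l : ℕ} (hxW : 2 ^ 64 * (x + 1) < 2 ^ W) (hl0 : 1 ≤ l)
    (hl : l ≤ blockLength x) : (l + 1) ^ 64 < 2 ^ W := by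
  have hle : l ^ 64 ≤ x + 1 := by
    rcases Nat.eq_zero_or_pos x with rfl | hx0
    · have h : blockLength 0 = 1 := by simp [blockLength]
      obtain rfl : l = 1 := by omega
      simp
    · exact ((Nat.pow_le_pow_left hl 64).trans (blockLength_pow_le hx0)).trans (by omega)
  refine lt_of_le_of_lt ?_ hxW
  calc (l + 1) ^ 64 ≤ (2 * l) ^ 64 := Nat.pow_le_pow_left (by omega) 64
    _ = 2 ^ 64 * l ^ 64 := mul_pow 2 l 64
    _ ≤ 2 ^ 64 * (x + 1) := Nat.mul_le_mul_left _ hle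

lemma computes_length_loop (hW : 0 < W) {x : ℕ} (hxW : 2 ^ 64 * (x + 1) < 2 ^ W) (k : ℕ) {l : ℕ}
    {r : Reg → ℕ} (hk : l + k = blockLength x) (hl0 : 1 ≤ l) (hx : r .x = x) (hl : r .l = l)
    (hQ : ∀ r', r' .x = x → r' .l = blockLength x → r' .n = r .n → r' .acc = r .acc → Q r' true) :
    Computes W (.loop lengthTest (.inc .l)) (routineCost W * (11 * (k + 1))) r Q := by
  have h1 : 1 ≤ routineCost W := by unfold routineCost; omega
  induction k generalizing l r with
  | zero =>
    obtain rfl : l = blockLength x := by omega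
    refine Computes.mono_time (Computes.loop (n := 0) (k := 0)
      (computes_lengthTest hW hx hl (pow_lt_of_le_blockLength hxW hl0 le_rfl)
        fun r' h₁ h₂ h₃ h₄ => ⟨fun _ => hQ r' h₁ h₂ h₃ h₄,
        fun h => absurd (lt_blockLength_succ_pow x) (of_decide_eq_false h)⟩)) (by nlinarith)
  | succ k ih =>
    have hlt := pow_lt_of_le_blockLength hxW hl0 (show l ≤ blockLength x by omega)
    have hle : (l + 1) ^ 64 ≤ x := by
      rcases Nat.eq_zero_or_pos x with rfl | hx0
      · have : blockLength 0 = 1 := by simp [blockLength]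
        omega
      · exact (Nat.pow_le_pow_left (by omega) 64).trans (blockLength_pow_le hx0)
    refine Computes.mono_time (Computes.loop (n := routineCost W)
      (k := routineCost W * (11 * (k + 1)))
      (computes_lengthTest hW hx hl hlt fun r' h₁ h₂ h₃ h₄ => ⟨fun h => ?_, fun _ => ?_⟩))
      (by nlinarith)
    · exact absurd hle (not_le.2 (of_decide_eq_true h))
    · refine Computes.inc (y := l + 1) (by rw [h₂])
        ((Nat.le_self_pow (by norm_num) _).trans_lt hlt) ?_
      refine ih (l := l + 1) (by omega) (by omega) (by simp [h₁]) (by simp)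
        (fun r₂ g₁ g₂ g₃ g₄ => hQ r₂ g₁ g₂ (by simpa [h₃] using g₃) (by simpa [h₄] using g₄))

lemma computes_lengthProgram (hW : 0 < W) {x : ℕ} (hxW : 2 ^ 64 * (x + 1) < 2 ^ W)
    (hr : r = Function.update (fun _ => 0) .x x) (hQ : ∀ r', Progress x 0 r' → Q r' true) :
    Computes W lengthProgram (routineCost W * (11 * blockLength x + 1)) r Q := by
  subst hr
  have h1 := blockLength_pos x
  refine Computes.mono_time (Computes.seq (Computes.inc (y := 1) (by simp)
    (Nat.one_lt_two_pow (by omega)) (computes_length_loop hW hxW (blockLength x - 1) (l := 1)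
      (by omega) le_rfl (by simp) (by simp) fun r' h₁ h₂ h₃ h₄ => hQ r' ⟨h₁, h₂, ?_, ?_⟩)))
    (by rw [show blockLength x - 1 + 1 = blockLength x by omega, mul_add, mul_one]; omega)
  · simpa using h₃
  · simpa [quotientSum] using h₄

lemma computes_endTest (hW : 0 < W) {x n : ℕ} (hr : Progress x n r) (h : (n + 1) ^ 2 < 2 ^ W)
    (hQ : ∀ r', Progress x n r' → r' .i = n + 1 → Q r' (decide (x < (n + 1) * (n + 1)))) :
    Computes W endTest (routineCost W * 4) r Q := by
  obtain ⟨h₁, h₂, h₃, h₄⟩ := hr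
  refine Computes.step (n := 3) (Computes.copy (y := n) h₃ fun _ => ?_)
  refine Computes.step (n := 2) (Computes.inc (y := n + 1) (by simp)
    ((Nat.le_self_pow (by norm_num) _).trans_lt h) ?_)
  refine Computes.step (n := 1) (Computes.mul (y := (n + 1) * (n + 1)) hW (by simp)
    (by rwa [← sq]) fun _ => ?_)
  refine Computes.last (Computes.lt (x := x) (y := (n + 1) * (n + 1)) (by simp [h₁]) (by simp)
    (hQ _ ⟨?_, ?_, ?_, ?_⟩ ?_))
  all_goals simp [h₁, h₂, h₃, h₄]

lemma computes_blockEndTest (hW : 0 < W) {x n : ℕ} (hr : Progress x n r) (hi : r .i = n + 1)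
    (h : (n + blockLength x) ^ 2 < 2 ^ W)
    (hQ : ∀ r', Progress x n r' → r' .i = n + 1 → r' .b = n + blockLength x →
      r' .sq = (n + blockLength x) * (n + blockLength x) →
      Q r' (decide (x < (n + blockLength x) * (n + blockLength x)))) :
    Computes W blockEndTest (routineCost W * 4) r Q := by
  obtain ⟨h₁, h₂, h₃, h₄⟩ := hr
  refine Computes.step (n := 3) (Computes.copy (y := n) h₃ fun _ => ?_)
  refine Computes.step (n := 2) (Computes.add (y := n + blockLength x) (by simp [h₂])
    ((Nat.le_self_pow (by norm_num) _).trans_lt h) ?_)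
  refine Computes.step (n := 1) (Computes.mul (y := (n + blockLength x) * (n + blockLength x)) hW
    (by simp) (by rwa [← sq]) fun _ => ?_)
  refine Computes.last (Computes.lt (x := x) (y := (n + blockLength x) * (n + blockLength x))
    (by simp [h₁]) (by simp) (hQ _ ⟨?_, ?_, ?_, ?_⟩ ?_ ?_ ?_))
  all_goals simp [h₁, h₂, h₃, h₄, hi]

lemma computes_singleStep (hW : 0 < W) {x n : ℕ} (hr : Progress x n r) (hi : r .i = n + 1)
    (hn : 2 * (n + 1) ≤ 2 ^ W) (h : 2 * ((n + 1) * x) < 2 ^ W)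
    (hQ : ∀ r' f, Progress x (n + 1) r' → Q r' f) :
    Computes W singleStep (routineCost W * 4) r Q := by
  obtain ⟨h₁, h₂, h₃, h₄⟩ := hr
  have hs : quotientSum x (n + 1) = quotientSum x n + x / (n + 1) := by
    rw [quotientSum, Finset.sum_range_succ]; rfl
  have hle := quotientSum_le x (n + 1)
  obtain ⟨q, hq⟩ : ∃ q, x / (n + 1) = q := ⟨_, rfl⟩
  rw [hq] at hs
  refine Computes.step (n := 3) (Computes.copy (y := n + 1) hi fun _ => ?_)
  refine Computes.step (n := 2) (Computes.divMod (y := q) (y' := x % (n + 1)) hW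
    (by simp [h₁, hi, hq]) (by simp [h₁, hi]) (by simp [hi]) (by simp [hi]; omega) fun _ => ?_)
  refine Computes.step (n := 1) (Computes.add (y := 2 * quotientSum x n + q)
    (by simp [h₄]) (by omega) ?_)
  refine Computes.last (Computes.add (y := 2 * quotientSum x (n + 1))
    (by simp [hs]; ring) (by omega) (hQ _ _ ⟨?_, ?_, ?_, ?_⟩))
  all_goals simp [h₁, h₂]

/-- The relevant registers while the block after `n`, which lies below the square root of `x`, is
examined. -/
structure Examination (x n : ℕ) (r : Reg → ℕ) : Prop extends Progress x n r where
  i_eq : r .i = n + 1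
  b_eq : r .b = n + blockLength x
  sq_eq : r .sq = (n + blockLength x) * (n + blockLength x)
  e_eq : r .e = blockError x (blockLength x) n
  xb_eq : r .xb = x * (n + blockLength x)

lemma Examination.congr {x n : ℕ} {r r' : Reg → ℕ} (h : Examination x n r)
    (hr : ∀ v, v.isFloorSum = false → r' v = r v) : Examination x n r' :=
  ⟨⟨(hr .x rfl).trans h.x_eq, (hr .l rfl).trans h.l_eq, (hr .n rfl).trans h.n_eq,
    (hr .acc rfl).trans h.acc_eq⟩, (hr .i rfl).trans h.i_eq, (hr .b rfl).trans h.b_eq,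
    (hr .sq rfl).trans h.sq_eq, (hr .e rfl).trans h.e_eq, (hr .xb rfl).trans h.xb_eq⟩

lemma floorSum_le (n m a o : ℕ) : floorSum n m a o ≤ n * (a * n + o) := by
  calc floorSum n m a o ≤ ∑ _i ∈ Finset.range n, (a * n + o) := by
        refine Finset.sum_le_sum fun i hi => (Nat.div_le_self _ _).trans ?_
        have := (Finset.mem_range.1 hi).le
        gcongr
    _ = n * (a * n + o) := by simp

variable {W : ℕ} {r : Reg → ℕ} {Q : (Reg → ℕ) → Bool → Prop}

/-- The magnitudes of the numbers that occur in the examination of a block. -/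
lemma block_bounds {x L n : ℕ} (hb : (n + L) * (n + L) ≤ x) :
    n + L ≤ x ∧ L * L * x ≤ x * x ∧ x * (n + L) ≤ x * x ∧ blockError x L n ≤ x * x := by
  have h1 : n + L ≤ (n + L) * (n + L) := Nat.le_mul_self _
  have h2 : L * L ≤ x := le_trans (Nat.mul_le_mul (by omega) (by omega)) hb
  have h3 : L * L * x ≤ x * x := Nat.mul_le_mul_right _ h2
  exact ⟨h1.trans hb, h3, Nat.mul_le_mul_left _ (h1.trans hb), (Nat.div_le_self _ _).trans h3⟩

lemma computes_blockPrepare (hW : 0 < W) {x n : ℕ} (hr : Progress x n r) (hi : r .i = n + 1)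
    (hb : r .b = n + blockLength x)
    (hsq : r .sq = (n + blockLength x) * (n + blockLength x))
    (hbx : (n + blockLength x) * (n + blockLength x) ≤ x) (hx : 4 * (x + 1) ^ 2 < 2 ^ W)
    (hQ : ∀ r' f, Examination x n r' → r' .fn = blockLength x →
      r' .fm = (n + blockLength x) * (n + blockLength x) → r' .fa = x →
      r' .fo = x * (n + blockLength x) → Q r' f) :
    Computes W blockPrepare (routineCost W * 8) r Q := by
  obtain ⟨h₁, h₂, h₃, h₄⟩ := hr
  obtain ⟨b₁, b₂, b₃, b₄⟩ := block_bounds hbx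
  have hxx : x * x ≤ (x + 1) ^ 2 := by nlinarith
  have hx1 : x + 1 ≤ (x + 1) ^ 2 := Nat.le_self_pow (by norm_num) _
  have hLL : blockLength x * blockLength x ≤ x :=
    le_trans (Nat.mul_le_mul (by omega) (by omega)) hbx
  have hL := blockLength_pos x
  refine Computes.step (n := 7) (Computes.mul (y := blockLength x * blockLength x) hW
    (by simp [h₂]) (by omega) fun _ => ?_)
  refine Computes.step (n := 6) (Computes.mul (y := blockLength x * blockLength x * x) hW
    (by simp [h₁]) (by omega) fun _ => ?_)
  refine Computes.step (n := 5) (Computes.divMod (y := blockError x (blockLength x) n)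
    (y' := blockLength x * blockLength x * x % (n + 1)) hW (by simp [hi, blockError])
    (by simp [hi]) (by simp [hi]) (by simp [hi]; omega) fun _ => ?_)
  refine Computes.step (n := 4) (Computes.mul (y := x * (n + blockLength x)) hW
    (by simp [h₁, hb]) (by omega) fun _ => ?_)
  refine Computes.step (n := 3) (Computes.copy (y := blockLength x) (by simp [h₂]) fun _ => ?_)
  refine Computes.step (n := 2) (Computes.copy
    (y := (n + blockLength x) * (n + blockLength x)) (by simp [hsq]) fun _ => ?_)
  refine Computes.step (n := 1) (Computes.copy (y := x) (by simp [h₁]) fun _ => ?_)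
  refine Computes.last (Computes.copy (y := x * (n + blockLength x)) (by simp) fun _ =>
    hQ _ _ ⟨⟨?_, ?_, ?_, ?_⟩, ?_, ?_, ?_, ?_, ?_⟩ ?_ ?_ ?_ ?_)
  all_goals simp [h₁, h₂, h₃, h₄, hi, hb, hsq]

lemma computes_blockPrepareUpper {x n : ℕ} (hr : Examination x n r)
    (hbx : (n + blockLength x) * (n + blockLength x) ≤ x) (hx : 4 * (x + 1) ^ 2 < 2 ^ W)
    (hQ : ∀ r' f, Examination x n r' → r' .lo = r .ans → r' .fn = blockLength x →
      r' .fm = (n + blockLength x) * (n + blockLength x) → r' .fa = x →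
      r' .fo = x * (n + blockLength x) + blockError x (blockLength x) n → Q r' f) :
    Computes W blockPrepareUpper (routineCost W * 6) r Q := by
  obtain ⟨⟨h₁, h₂, h₃, h₄⟩, hi, hb, hsq, he, hxb⟩ := hr
  obtain ⟨b₁, b₂, b₃, b₄⟩ := block_bounds hbx
  have hxx : x * x ≤ (x + 1) ^ 2 := by nlinarith
  refine Computes.step (n := 5) (Computes.copy (y := r .ans) rfl fun _ => ?_)
  refine Computes.step (n := 4) (Computes.copy (y := blockLength x) (by simp [h₂]) fun _ => ?_)
  refine Computes.step (n := 3) (Computes.copy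
    (y := (n + blockLength x) * (n + blockLength x)) (by simp [hsq]) fun _ => ?_)
  refine Computes.step (n := 2) (Computes.copy (y := x) (by simp [h₁]) fun _ => ?_)
  refine Computes.step (n := 1) (Computes.copy (y := x * (n + blockLength x)) (by simp [hxb])
    fun _ => ?_)
  refine Computes.last (Computes.add
    (y := x * (n + blockLength x) + blockError x (blockLength x) n) (by simp [he]) (by omega)
    (hQ _ _ ⟨⟨?_, ?_, ?_, ?_⟩, ?_, ?_, ?_, ?_, ?_⟩ ?_ ?_ ?_ ?_ ?_))
  all_goals simp [h₁, h₂, h₃, h₄, hi, hb, hsq, he, hxb]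

lemma computes_blockTest (hW : 0 < W) {x n : ℕ} (hr : Progress x n r) (hi : r .i = n + 1)
    (hb : r .b = n + blockLength x)
    (hsq : r .sq = (n + blockLength x) * (n + blockLength x))
    (hbx : (n + blockLength x) * (n + blockLength x) ≤ x) (hx : 16 * (x + 1) ^ 6 < 2 ^ W)
    (hQ : ∀ r', Examination x n r' → r' .ans = 2 * blockUpper x (blockLength x) n →
      Q r' (decide (2 * blockLower x (blockLength x) n < 2 * blockUpper x (blockLength x) n))) :
    Computes W blockTest (2 * floorSumCost W + routineCost W * 15) r Q := by
  obtain ⟨b₁, b₂, b₃, b₄⟩ := block_bounds hbx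
  have hL := blockLength_pos x
  have hX : 1 ≤ x + 1 := by omega
  have hp2 : (x + 1) ^ 2 ≤ (x + 1) ^ 6 := Nat.pow_le_pow_right hX (by norm_num)
  have hp1 : x + 1 ≤ (x + 1) ^ 2 := Nat.le_self_pow (by norm_num) _
  have hp3 : (x + 1) ^ 3 ≤ (x + 1) ^ 6 := Nat.pow_le_pow_right hX (by norm_num)
  have hxx : x * x ≤ (x + 1) ^ 2 := by nlinarith
  have hB : 2 * (2 * (x + 1) ^ 2) ^ 3 < 2 ^ W := by
    calc 2 * (2 * (x + 1) ^ 2) ^ 3 = 16 * (x + 1) ^ 6 := by ring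
      _ < 2 ^ W := hx
  have hs : ∀ o, o ≤ 2 * (x * x) →
      2 * floorSum (blockLength x) ((n + blockLength x) * (n + blockLength x)) x o < 2 ^ W := by
    intro o ho
    have h1 := floorSum_le (blockLength x) ((n + blockLength x) * (n + blockLength x)) x o
    have h2 : blockLength x * (x * blockLength x + o) ≤ x * (x * x + 2 * (x * x)) := by
      gcongr <;> omega
    have h3 : x * (x * x + 2 * (x * x)) ≤ 3 * (x + 1) ^ 3 := by
      calc x * (x * x + 2 * (x * x)) = 3 * x ^ 3 := by ring
        _ ≤ 3 * (x + 1) ^ 3 := by gcongr; omega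
    omega
  have hm : 0 < (n + blockLength x) * (n + blockLength x) := Nat.mul_pos (by omega) (by omega)
  refine Computes.mono_time (m := routineCost W * 8 + (floorSumCost W + (routineCost W * 6 +
    (floorSumCost W + routineCost W)))) (Computes.seq (computes_blockPrepare hW hr hi hb hsq hbx
    (by omega) fun r₁ _ e₁ g₁ g₂ g₃ g₄ => Computes.seq (computes_floorSum hW hB g₁ g₂ g₃ g₄ hm
    (by omega) (by omega) (by omega) (by omega) (hs _ (by omega)) fun r₂ f₂ a₂ => ?_)))
    (by omega)
  refine Computes.seq (computes_blockPrepareUpper (e₁.congr f₂) hbx (by omega)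
    fun r₃ _ e₃ l₃ g₁ g₂ g₃ g₄ => Computes.seq (computes_floorSum hW hB g₁ g₂ g₃ g₄ hm
    (by omega) (by omega) (by omega) (by omega) (hs _ (by omega)) fun r₄ f₄ a₄ => ?_))
  exact Computes.lt ((f₄ .lo rfl).trans (l₃.trans a₂)) a₄ (hQ r₄ (e₃.congr f₄) a₄)

lemma computes_blockStep {x n : ℕ} (hr : Examination x n r)
    (ha : r .ans = 2 * blockUpper x (blockLength x) n) (hg : GoodBlock x (blockLength x) n)
    (hx : 2 * ((n + blockLength x) * x) < 2 ^ W)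
    (hQ : ∀ r' f, Progress x (n + blockLength x) r' → Q r' f) :
    Computes W blockStep (routineCost W * 2) r Q := by
  obtain ⟨⟨h₁, h₂, h₃, h₄⟩, hi, hb, hsq, he, hxb⟩ := hr
  have hq := hg.quotientSum_add
  have hle := quotientSum_le x (n + blockLength x)
  refine Computes.step (n := 1) (Computes.add (y := 2 * quotientSum x (n + blockLength x))
    (by rw [h₄, ha, hq]; ring) (by omega) ?_)
  refine Computes.last (Computes.copy (y := n + blockLength x) (by simp [hb]) fun _ =>
    hQ _ _ ⟨?_, ?_, ?_, ?_⟩)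
  all_goals simp [h₁, h₂]

/-- The number of instructions for a round of the main loop, at most. -/
def roundCost (W : ℕ) : ℕ := 2 * floorSumCost W + routineCost W * 30

lemma computes_mainLoop (hW : 0 < W) {x : ℕ} (hx : 16 * (x + 1) ^ 6 < 2 ^ W) (k : ℕ) {n : ℕ}
    {r : Reg → ℕ} (hr : Progress x n r) (hn : n ≤ Nat.sqrt x)
    (hk : rounds x (blockLength x) n ≤ k)
    (hQ : ∀ r', Progress x (Nat.sqrt x) r' → Q r' true) :
    Computes W mainLoop (roundCost W * (k + 1)) r Q := by
  have hX : 1 ≤ x + 1 := by omega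
  have hp2 : (x + 1) ^ 2 ≤ (x + 1) ^ 6 := Nat.pow_le_pow_right hX (by norm_num)
  have hp1 : x + 1 ≤ (x + 1) ^ 2 := Nat.le_self_pow (by norm_num) _
  have hxx : (x + 1) * x ≤ (x + 1) ^ 2 := by nlinarith
  have hsx := Nat.sqrt_le_self x
  have hc : 1 ≤ routineCost W := by unfold routineCost; omega
  have hL := blockLength_pos x
  have hLx := blockLength_le x
  have hn2 : (n + 1) ^ 2 ≤ (x + 1) ^ 2 := Nat.pow_le_pow_left (by omega) 2
  have hnL2 : (n + blockLength x) ^ 2 ≤ 4 * (x + 1) ^ 2 := by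
    calc (n + blockLength x) ^ 2 ≤ (2 * (x + 1)) ^ 2 := Nat.pow_le_pow_left (by omega) 2
      _ = 4 * (x + 1) ^ 2 := by ring
  have hend : ∀ r', Progress x n r' → x < (n + 1) * (n + 1) → Q r' true := by
    intro r' h h'
    have := Nat.sqrt_lt.2 h'
    obtain rfl : n = Nat.sqrt x := by omega
    exact hQ r' h
  induction k generalizing n r with
  | zero =>
    refine Computes.mono_time (Computes.loop (n := 0) (k := 0) (computes_endTest hW hr (by omega)
      fun r₁ p₁ i₁ => ⟨fun h => hend r₁ p₁ (of_decide_eq_true h), fun h => ?_⟩))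
      (by unfold roundCost; omega)
    have hlt : n < Nat.sqrt x := Nat.le_sqrt.2 (not_lt.1 (of_decide_eq_false h))
    by_cases hg : GoodBlock x (blockLength x) n
    · have := rounds_of_good hL hg; omega
    · have := rounds_of_not_good hlt hg; omega
  | succ k ih =>
    refine Computes.mono_time (Computes.loop
      (n := routineCost W * 4 + (1 + ((2 * floorSumCost W + routineCost W * 15) +
        (1 + routineCost W * 4))))
      (k := roundCost W * (k + 1)) (computes_endTest hW hr (by omega)
      fun r₁ p₁ i₁ => ⟨fun h => hend r₁ p₁ (of_decide_eq_true h), fun h => ?_⟩))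
      (by have h : roundCost W = 2 * floorSumCost W + routineCost W * 30 := rfl
          rw [mul_add (roundCost W) (k + 1) 1, mul_one]
          omega)
    have hlt : n < Nat.sqrt x := Nat.le_sqrt.2 (not_lt.1 (of_decide_eq_false h))
    -- the rest of the loop, after a step to `n'` that has used up one round
    have hrest : ∀ n' r', Progress x n' r' → n' ≤ Nat.sqrt x →
        rounds x (blockLength x) n' + 1 ≤ rounds x (blockLength x) n →
        Computes W mainLoop (roundCost W * (k + 1)) r' Q := by
      intro n' r' h₁ h₂ h₃
      refine ih h₁ h₂ (by omega) ?_ ?_ ?_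
      · exact Nat.pow_le_pow_left (by omega) 2
      · calc (n' + blockLength x) ^ 2 ≤ (2 * (x + 1)) ^ 2 := Nat.pow_le_pow_left (by omega) 2
          _ = 4 * (x + 1) ^ 2 := by ring
      · intro r'' g g'
        have := Nat.sqrt_lt.2 g'
        obtain rfl : n' = Nat.sqrt x := by omega
        exact hQ r'' g
    have hstep : ∀ r', Progress x n r' → r' .i = n + 1 → ¬GoodBlock x (blockLength x) n →
        Computes W singleStep (routineCost W * 4) r'
          fun r'' _ => Computes W mainLoop (roundCost W * (k + 1)) r'' Q := by
      intro r' h₁ h₂ h₃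
      refine computes_singleStep hW h₁ h₂ (by omega) ?_ fun r'' _ h₄ =>
        hrest _ r'' h₄ hlt (rounds_of_not_good hlt h₃)
      have : (n + 1) * x ≤ (x + 1) * x := Nat.mul_le_mul_right _ (by omega)
      omega
    refine Computes.branch (computes_blockEndTest hW p₁ i₁ (by omega) fun r₂ p₂ i₂ b₂ s₂ =>
      ⟨fun h => ?_, fun h => ?_⟩)
    · exact (hstep r₂ p₂ i₂ fun hg => absurd hg.1 (not_le.2 (of_decide_eq_true h))).mono_time
        (by omega)
    · have hbx := not_lt.1 (of_decide_eq_false h)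
      refine Computes.branch (computes_blockTest hW p₂ i₂ b₂ s₂ hbx hx fun r₃ e₃ a₃ =>
        ⟨fun h => ?_, fun h => ?_⟩)
      · have := of_decide_eq_true h
        exact hstep r₃ e₃.toProgress e₃.i_eq fun hg => by have := hg.2; omega
      · have := of_decide_eq_false h
        have hg : GoodBlock x (blockLength x) n := ⟨hbx, by omega⟩
        have hle := hg.le_sqrt
        have : (n + blockLength x) * x ≤ (x + 1) * x := Nat.mul_le_mul_right _ (by omega)
        exact (computes_blockStep e₃ a₃ hg (by omega) fun r₄ _ h₄ =>
          hrest _ r₄ h₄ hle (rounds_of_good hL hg)).mono_time (by omega)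

/-- The number of instructions that the program for the divisor sum carries out, at most. -/
def programCost (W x : ℕ) : ℕ :=
  roundCost W * (blockLength x + rounds x (blockLength x) 0 + 2)

lemma computes_divisorSumProgram (hW : 0 < W) {x : ℕ} (hx : 2 ^ 64 * (x + 1) ^ 6 < 2 ^ W)
    (hr : r = Function.update (fun _ => 0) .x x) :
    Computes W divisorSumProgram (programCost W x) r fun r' _ => r' .acc = divisorSum x := by
  have hX : 1 ≤ x + 1 := by omega
  have hp1 : x + 1 ≤ (x + 1) ^ 6 := Nat.le_self_pow (by norm_num) _
  refine Computes.mono_time (m := routineCost W * (11 * blockLength x + 1) +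
    (roundCost W * (rounds x (blockLength x) 0 + 1) + routineCost W * 2))
    (Computes.seq (computes_lengthProgram hW (by omega) hr fun r₁ p₁ =>
      Computes.seq (computes_mainLoop hW (by omega) _ p₁ (Nat.zero_le _) le_rfl fun r₂ p₂ => ?_)))
    ?_
  · have hsum := divisorSum_add_sq x
    have hsx := Nat.sqrt_le x
    refine Computes.step (n := 1) (Computes.mul (y := Nat.sqrt x * Nat.sqrt x) hW
      (by rw [p₂.n_eq]) (by omega) fun _ => ?_)
    refine Computes.last (Computes.sub (y := divisorSum x) ?_ ?_ ?_)
    · simp [p₂.acc_eq]; omega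
    · simp [p₂.acc_eq]; omega
    · simp
  · unfold programCost roundCost
    nlinarith [Nat.zero_le (floorSumCost W * blockLength x), Nat.zero_le (floorSumCost W),
      Nat.zero_le (routineCost W * blockLength x)]

/-- The width of the registers for the input `x`. It accommodates the largest numbers that occur,
among them the 64th power in the computation of the length of the blocks. -/
def width (x : ℕ) : ℕ :=
  (Computability.encodeNat x).length + ((Computability.encodeNat x).length + 1) * 65

lemma lt_two_pow_length (x : ℕ) : x < 2 ^ (Computability.encodeNat x).length := by
  have h := rowValue_lt () (inputColumns () (Computability.encodeNat x))
  rwa [rowValue_inputColumns, inputColumns, List.length_map] at h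

/-- The divisor sum is computed in time proportional to the number of digits of `x` times the number
of instructions of the program. -/
theorem exists_divisorSum_computableInTimeAtMost :
    ∃ C : ℕ, ComputableInTimeAtMost divisorSum fun x =>
      C * (((Computability.encodeNat x).length + 1) * (programCost (width x) x + 1)) := by
  refine exists_computableInTimeAtMost divisorSumProgram (.inr .x) (.inr .acc) 65 divisorSum
    (fun x => programCost (width x) x) fun x W hW => ?_
  obtain rfl : W = width x := hW
  set ℓ := (Computability.encodeNat x).length with hℓ
  have hw : 64 + 6 * ℓ < width x := by unfold width; omega
  have hlt : x + 1 ≤ 2 ^ ℓ := lt_two_pow_length x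
  have hx : 2 ^ 64 * (x + 1) ^ 6 < 2 ^ width x := by
    calc 2 ^ 64 * (x + 1) ^ 6 ≤ 2 ^ 64 * (2 ^ ℓ) ^ 6 := by gcongr
      _ = 2 ^ (64 + 6 * ℓ) := by rw [← pow_mul, ← pow_add]; congr 1; ring
      _ < 2 ^ width x := Nat.pow_lt_pow_right (by norm_num) hw
  have hx' : x < 2 ^ width x := by
    have := Nat.le_self_pow (show 6 ≠ 0 by norm_num) (x + 1)
    omega
  refine computes_divisorSumProgram (by omega) hx rfl
    (Function.update (fun _ => 0) (.inr .x) x, false) (fun v => ?_) (fun v => ?_)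
  · by_cases h : v = .inr .x
    · subst h; simpa using hx'
    · simp [h]
  · by_cases h : v = .x
    · subst h; simp
    · simp [h]

/-! ### The number of divisors of a single number -/

lemma succ_pow_three_le (e : ℕ) : (e + 1) ^ 3 ≤ 8 * 2 ^ e := by
  rcases Nat.lt_or_ge e 3 with he | he
  · interval_cases e <;> norm_num
  · induction e, he using Nat.le_induction with
    | base => norm_num
    | succ e he ih =>
      have : (e + 1 + 1) ^ 3 ≤ 2 * (e + 1) ^ 3 := by
        obtain ⟨d, rfl⟩ := Nat.exists_eq_add_of_le he
        ring_nf
        nlinarith [Nat.zero_le d]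
      rw [pow_succ 2 e]
      omega

lemma succ_pow_three_le_eight_pow (e : ℕ) : (e + 1) ^ 3 ≤ 8 ^ e := by
  have h : e + 1 ≤ 2 ^ e := Nat.lt_two_pow_self
  calc (e + 1) ^ 3 ≤ (2 ^ e) ^ 3 := Nat.pow_le_pow_left h 3
    _ = 8 ^ e := by rw [← pow_mul, mul_comm, pow_mul]; norm_num

/-- The number of divisors of `j` is `O(j ^ (1 / 3))`: in the product over the primes, only those
less than `8` contribute a factor that may exceed `1`. -/
lemma card_divisors_pow_three_le {j : ℕ} (hj : j ≠ 0) : j.divisors.card ^ 3 ≤ 8 ^ 8 * j := by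
  have h : ∀ p ∈ j.primeFactors, (j.factorization p + 1) ^ 3 ≤
      (if p < 8 then 8 else 1) * p ^ j.factorization p := by
    intro p hp
    have hp2 := (Nat.prime_of_mem_primeFactors hp).two_le
    split_ifs with h8
    · exact (succ_pow_three_le _).trans (Nat.mul_le_mul_left 8 (Nat.pow_le_pow_left hp2 _))
    · rw [one_mul]
      exact (succ_pow_three_le_eight_pow _).trans (Nat.pow_le_pow_left (by omega) _)
  have hc : (j.primeFactors.filter (· < 8)).card ≤ 8 :=
    (Finset.card_le_card (t := Finset.range 8) fun p hp =>
      Finset.mem_range.2 (Finset.mem_filter.1 hp).2).trans_eq (Finset.card_range 8)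
  calc j.divisors.card ^ 3 = ∏ p ∈ j.primeFactors, (j.factorization p + 1) ^ 3 := by
        rw [Nat.card_divisors hj, Finset.prod_pow]
    _ ≤ ∏ p ∈ j.primeFactors, (if p < 8 then 8 else 1) * p ^ j.factorization p :=
        Finset.prod_le_prod' h
    _ = 8 ^ (j.primeFactors.filter (· < 8)).card * j := by
        rw [Finset.prod_mul_distrib, Finset.prod_ite, Finset.prod_const, Finset.prod_const_one,
          mul_one]
        congr 1
        exact Nat.prod_factorization_pow_eq_self hj
    _ ≤ 8 ^ 8 * j := Nat.mul_le_mul_right _ (Nat.pow_le_pow_right (by norm_num) hc)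

/-! ### The number of bad blocks -/

/-- If the two linear bounds for a block disagree, then an integer `m` lies between them at some
point `d` of the block. As both bounds are within `L ^ 4 / d` of `x / d`, the multiple `d * m` of
`d` is within `L ^ 4` of `x`. The hypothesis `hs` says that `n + 1` exceeds `√x / L`. -/
lemma exists_dvd_of_not_goodBlock {x L n : ℕ} (hs : Nat.sqrt x < (n + 1) * L)
    (hb : (n + L) * (n + L) ≤ x) (h : ¬GoodBlock x L n) :
    ∃ t < L, ∃ j ∈ Finset.Icc (x - L ^ 4) (x + L ^ 4), n + L - t ∣ j := by
  have hlt : blockLower x L n < blockUpper x L n := not_le.1 fun h' => h ⟨hb, h'⟩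
  unfold blockLower blockUpper floorSum at hlt
  obtain ⟨t, ht, hlt⟩ := Finset.exists_lt_of_sum_lt hlt
  have ht := Finset.mem_range.1 ht
  have hn : n + 1 ≤ n + L := by omega
  have hxn : x ≤ (n + 1) * (n + 1) * (L * L) :=
    (Nat.sqrt_lt.1 hs).le.trans_eq (by ring)
  have he : blockError x L n ≤ (n + 1) * L ^ 4 := by
    refine Nat.div_le_of_le_mul ?_
    calc L * L * x ≤ L * L * ((n + 1) * (n + 1) * (L * L)) := Nat.mul_le_mul_left _ hxn
      _ = (n + 1) * ((n + 1) * L ^ 4) := by ring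
  have hpos : 0 < (n + L) * (n + L) := Nat.mul_pos (by omega) (by omega)
  generalize hm : (x * t + (x * (n + L) + blockError x L n)) / ((n + L) * (n + L)) = m at hlt
  rw [Nat.div_lt_iff_lt_mul hpos] at hlt
  have hm' : m * ((n + L) * (n + L)) ≤ x * t + (x * (n + L) + blockError x L n) :=
    (Nat.le_div_iff_mul_le hpos).1 hm.ge
  refine ⟨t, ht, (n + L - t) * m, ?_, dvd_mul_right _ _⟩
  obtain ⟨d, hd⟩ : ∃ d, n + L = d + t := ⟨n + L - t, by omega⟩
  rw [hd] at hm' hlt hpos ⊢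
  have hnd : n + 1 ≤ d := by omega
  rw [Nat.add_sub_cancel, Finset.mem_Icc]
  generalize blockError x L n = e at *
  constructor
  -- `x - L ^ 4 ≤ d * m`: the tangent at `d + t` lies below `x / d` by
  -- `x * t ^ 2 / (d * (d + t) ^ 2)`
  · rw [Nat.sub_le_iff_le_add]
    refine Nat.le_of_mul_le_mul_right ?_ hpos
    have h₁ : x * (t * t) ≤ L ^ 4 * ((d + t) * (d + t)) := by
      calc x * (t * t) ≤ ((n + 1) * (n + 1) * (L * L)) * (L * L) := by gcongr
        _ = L ^ 4 * ((n + 1) * (n + 1)) := by ring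
        _ ≤ L ^ 4 * ((d + t) * (d + t)) :=
          Nat.mul_le_mul_left _ (Nat.mul_le_mul (by omega) (by omega))
    nlinarith [Nat.mul_le_mul_left d hlt.le]
  -- `d * m ≤ x + L ^ 4`: the upper bound exceeds the tangent by `e / (d + t) ^ 2`
  · refine Nat.le_of_mul_le_mul_right ?_ hpos
    have h₁ : d * e ≤ L ^ 4 * ((d + t) * (d + t)) := by
      calc d * e ≤ (d + t) * ((d + t) * L ^ 4) := by
            gcongr
            · omega
            · exact he.trans (Nat.mul_le_mul_right _ (by omega))
        _ = L ^ 4 * ((d + t) * (d + t)) := by ring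
    nlinarith [Nat.mul_le_mul_left d hm', Nat.zero_le (x * (t * t))]

/-- The bad blocks start near `0`, or near the square root of `x`, or they give rise to a divisor of
a number close to `x`. -/
lemma card_not_goodBlock_le {x L M : ℕ} (hL : 0 < L) (hx : L ^ 4 < x)
    (hM : ∀ j ≤ x + L ^ 4, j ≠ 0 → j.divisors.card ≤ M) :
    ((Finset.Ico 0 (Nat.sqrt x)).filter fun n => ¬GoodBlock x L n).card ≤
      Nat.sqrt x / L + L + L * ((2 * L ^ 4 + 1) * M) := by
  set J := Finset.Icc (x - L ^ 4) (x + L ^ 4) with hJ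
  have hsub : ((Finset.Ico 0 (Nat.sqrt x)).filter fun n => ¬GoodBlock x L n) ⊆
      Finset.range (Nat.sqrt x / L) ∪ Finset.Ico (Nat.sqrt x - L) (Nat.sqrt x) ∪
        (Finset.range L ×ˢ J.sigma fun j => j.divisors).image fun p => p.2.2 + p.1 - L := by
    intro n hn
    obtain ⟨hn, hbad⟩ := Finset.mem_filter.1 hn
    have hn := (Finset.mem_Ico.1 hn).2
    by_cases h₁ : n < Nat.sqrt x / L
    · simp [h₁]
    by_cases h₂ : Nat.sqrt x < n + L
    · refine Finset.mem_union_left _ (Finset.mem_union_right _ (Finset.mem_Ico.2 ?_))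
      omega
    refine Finset.mem_union_right _ (Finset.mem_image.2 ?_)
    obtain ⟨t, ht, j, hj, hdvd⟩ := exists_dvd_of_not_goodBlock
      ((Nat.div_lt_iff_lt_mul hL).1 (by omega)) (Nat.le_sqrt.1 (not_lt.1 h₂)) hbad
    refine ⟨(t, ⟨j, n + L - t⟩), ?_, by simp; omega⟩
    have hj0 : j ≠ 0 := by have := (Finset.mem_Icc.1 hj).1; omega
    simp only [Finset.mem_product, Finset.mem_range, Finset.mem_sigma, Nat.mem_divisors]
    exact ⟨ht, hj, hdvd, hj0⟩
  have hsigma : (J.sigma fun j => j.divisors).card ≤ (2 * L ^ 4 + 1) * M := by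
    rw [Finset.card_sigma]
    calc ∑ j ∈ J, j.divisors.card ≤ ∑ _j ∈ J, M := Finset.sum_le_sum fun j hj => by
          have := Finset.mem_Icc.1 hj
          exact hM j this.2 (by omega)
      _ = (2 * L ^ 4 + 1) * M := by
          rw [Finset.sum_const, smul_eq_mul, hJ, Nat.card_Icc]
          congr 1
          omega
  calc _ ≤ _ := Finset.card_le_card hsub
    _ ≤ Nat.sqrt x / L + L + L * ((2 * L ^ 4 + 1) * M) := by
      refine (Finset.card_union_le _ _).trans (add_le_add ((Finset.card_union_le _ _).trans ?_)
        (Finset.card_image_le.trans ?_))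
      · rw [Finset.card_range, Nat.card_Ico]
        omega
      · rw [Finset.card_product, Finset.card_range]
        exact Nat.mul_le_mul_left _ hsigma

/-! ### The running time -/

lemma le_blockLength_pow {x : ℕ} : x ≤ 2 ^ 64 * blockLength x ^ 64 := by
  have h := lt_blockLength_succ_pow x
  have h₁ := blockLength_pos x
  calc x ≤ (blockLength x + 1) ^ 64 := h.le
    _ ≤ (2 * blockLength x) ^ 64 := Nat.pow_le_pow_left (by omega) 64
    _ = 2 ^ 64 * blockLength x ^ 64 := mul_pow ..

/-- As `x` is about `L ^ 64` for the length `L` of the blocks, the terms of order `√x / L` in the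
number of rounds have order `L ^ 31`, and dominate the others. -/
lemma rounds_add_le {x : ℕ} (hx : 1 < x) :
    blockLength x + rounds x (blockLength x) 0 + 2 ≤ 2 ^ 36 * blockLength x ^ 31 := by
  set L := blockLength x with hLdef
  have hL : 1 ≤ L := blockLength_pos x
  have hLx : L ^ 64 ≤ x := blockLength_pow_le (by omega)
  have hxL : x ≤ 2 ^ 64 * L ^ 64 := le_blockLength_pow
  have h4 : L ^ 4 < x := by
    rcases hL.eq_or_lt with h | h
    · rwa [← h, one_pow]
    · exact (Nat.pow_lt_pow_right h (by norm_num)).trans_le hLx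
  -- `22` is the least integer that is at least `64 / 3`
  have hM : ∀ j ≤ x + L ^ 4, j ≠ 0 → j.divisors.card ≤ 2 ^ 30 * L ^ 22 := by
    intro j hj hj0
    refine le_of_pow_le_pow_left₀ (n := 3) (by norm_num) (Nat.zero_le _) ?_
    calc j.divisors.card ^ 3 ≤ 8 ^ 8 * j := card_divisors_pow_three_le hj0
      _ ≤ 8 ^ 8 * (2 * (2 ^ 64 * L ^ 64)) := Nat.mul_le_mul_left _ (by omega)
      _ = 2 ^ 89 * L ^ 64 := by ring
      _ ≤ 2 ^ 90 * L ^ 66 := Nat.mul_le_mul (by norm_num) (Nat.pow_le_pow_right hL (by norm_num))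
      _ = (2 ^ 30 * L ^ 22) ^ 3 := by ring
  have hsqrt : Nat.sqrt x / L ≤ 2 ^ 32 * L ^ 31 := by
    have : Nat.sqrt x ≤ 2 ^ 32 * L ^ 32 := by
      refine (Nat.sqrt_le_sqrt hxL).trans_eq ?_
      rw [show 2 ^ 64 * L ^ 64 = (2 ^ 32 * L ^ 32) * (2 ^ 32 * L ^ 32) by ring, Nat.sqrt_eq]
    refine Nat.div_le_of_le_mul (this.trans_eq (by ring))
  have h₁ := card_not_goodBlock_le hL h4 hM
  have h₂ : L * ((2 * L ^ 4 + 1) * (2 ^ 30 * L ^ 22)) ≤ 2 ^ 32 * L ^ 31 := by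
    calc L * ((2 * L ^ 4 + 1) * (2 ^ 30 * L ^ 22))
        ≤ L * ((4 * L ^ 4) * (2 ^ 30 * L ^ 22)) := by
          have := Nat.one_le_pow 4 L hL
          gcongr
          omega
      _ = 2 ^ 32 * L ^ 27 := by ring
      _ ≤ 2 ^ 32 * L ^ 31 := Nat.mul_le_mul_left _ (Nat.pow_le_pow_right hL (by norm_num))
  have h₃ : L ≤ L ^ 31 := Nat.le_self_pow (by norm_num) L
  have h₄ : rounds x L 0 ≤ Nat.sqrt x / L +
      (Nat.sqrt x / L + L + L * ((2 * L ^ 4 + 1) * (2 ^ 30 * L ^ 22))) := by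
    unfold rounds
    rw [Nat.sub_zero]
    exact Nat.add_le_add_left h₁ _
  omega

lemma two_pow_length_le {x : ℕ} (hx : x ≠ 0) :
    2 ^ (Computability.encodeNat x).length ≤ 2 * x := by
  induction x using Nat.strong_induction_on with
  | _ x ih =>
    obtain ⟨b, n, rfl⟩ : ∃ (b : Bool) (n : ℕ), x = b.toNat + 2 * n := by
      have h := Nat.mod_add_div x 2
      rw [Nat.mod_two_of_bodd] at h
      exact ⟨x.bodd, x / 2, h.symm⟩
    rw [encodeNat_bit]
    split_ifs with h
    · simp [h] at hx
    rw [List.length_cons, pow_succ]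
    rcases Nat.eq_zero_or_pos n with rfl | hn
    · cases b
      · simp at hx
      · decide
    · have := ih n (by omega) hn.ne'
      omega

/-- The number of digits of `x` is `O(x ^ (1 / 384))`, so that its cube fits into the exponent
`1 / 128` that the number of rounds leaves. -/
lemma length_add_one_le {x : ℕ} (hx : 0 < x) :
    ((Computability.encodeNat x).length : ℝ) + 1 ≤ 2000 * (x : ℝ) ^ ((1 : ℝ) / 384) := by
  have hx1 : (1 : ℝ) ≤ x := by exact_mod_cast hx
  have hr : (1 : ℝ) ≤ (x : ℝ) ^ ((1 : ℝ) / 384) := Real.one_le_rpow hx1 (by norm_num)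
  have h : (2 : ℝ) ^ (Computability.encodeNat x).length ≤ 2 * x := by
    exact_mod_cast two_pow_length_le hx.ne'
  have h₁ := Real.log_le_log (by positivity) h
  rw [Real.log_pow, Real.log_mul (by norm_num) (by positivity)] at h₁
  have h₂ := Real.log_le_rpow_div (x := (x : ℝ)) (by positivity)
    (show (0 : ℝ) < 1 / 384 by norm_num)
  have h₃ := Real.log_two_gt_d9
  have h₄ := Real.log_two_lt_d9
  rw [div_div_eq_mul_div, div_one] at h₂
  set ℓ := ((Computability.encodeNat x).length : ℝ)
  have : (0 : ℝ) ≤ ℓ := Nat.cast_nonneg _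
  nlinarith

lemma programCost_width_le {x : ℕ} (hx : 1 < x) :
    ((Computability.encodeNat x).length + 1) * (programCost (width x) x + 1) ≤
      2 ^ 60 * (((Computability.encodeNat x).length + 1) ^ 3 * blockLength x ^ 31) := by
  have h := rounds_add_le hx
  have hW : width x + 1 ≤ 66 * ((Computability.encodeNat x).length + 1) := by unfold width; omega
  set ℓ := (Computability.encodeNat x).length
  have hr : roundCost (width x) + 1 ≤ 1000 * (width x + 1) ^ 2 := by
    unfold roundCost floorSumCost routineCost
    nlinarith [Nat.zero_le (width x)]
  have hp : programCost (width x) x + 1 ≤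
      1000 * (66 * (ℓ + 1)) ^ 2 * (2 ^ 36 * blockLength x ^ 31) := by
    calc programCost (width x) x + 1
        ≤ (roundCost (width x) + 1) * (blockLength x + rounds x (blockLength x) 0 + 2) := by
          rw [programCost, add_mul]
          omega
      _ ≤ 1000 * (66 * (ℓ + 1)) ^ 2 * (2 ^ 36 * blockLength x ^ 31) :=
          Nat.mul_le_mul (hr.trans (Nat.mul_le_mul_left _ (Nat.pow_le_pow_left hW 2))) h
  calc (ℓ + 1) * (programCost (width x) x + 1)
      ≤ (ℓ + 1) * (1000 * (66 * (ℓ + 1)) ^ 2 * (2 ^ 36 * blockLength x ^ 31)) :=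
        Nat.mul_le_mul_left _ hp
    _ = (1000 * 66 ^ 2 * 2 ^ 36) * ((ℓ + 1) ^ 3 * blockLength x ^ 31) := by ring
    _ ≤ 2 ^ 60 * ((ℓ + 1) ^ 3 * blockLength x ^ 31) := Nat.mul_le_mul_right _ (by norm_num)

lemma blockLength_le_rpow {x : ℕ} (hx : 0 < x) :
    (blockLength x : ℝ) ≤ (x : ℝ) ^ ((1 : ℝ) / 64) := by
  have h : ((blockLength x : ℕ) : ℝ) ^ 64 ≤ x := by exact_mod_cast blockLength_pow_le hx
  calc (blockLength x : ℝ) = ((blockLength x : ℝ) ^ 64) ^ ((1 : ℝ) / 64) := by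
        rw [← Real.rpow_natCast, ← Real.rpow_mul (Nat.cast_nonneg _)]; norm_num
    _ ≤ (x : ℝ) ^ ((1 : ℝ) / 64) := Real.rpow_le_rpow (by positivity) h (by norm_num)

lemma isBigO_programCost (C : ℕ) :
    (fun x : ℕ => ((C * (((Computability.encodeNat x).length + 1) *
        (programCost (width x) x + 1)) : ℕ) : ℝ)) =O[Filter.atTop]
      fun x : ℕ => (x : ℝ) ^ ((1 : ℝ) / 2 - 1 / 128) := by
  refine IsBigO.of_bound (C * (2 ^ 60 * 2000 ^ 3)) (Filter.eventually_atTop.2 ⟨2, fun x hx => ?_⟩)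
  have hx0 : (0 : ℝ) < x := by exact_mod_cast (show 0 < x by omega)
  rw [Real.norm_of_nonneg (Nat.cast_nonneg _), Real.norm_of_nonneg (by positivity), Nat.cast_mul,
    mul_assoc]
  refine mul_le_mul_of_nonneg_left ?_ (Nat.cast_nonneg _)
  have h₁ := length_add_one_le (show 0 < x by omega)
  have h₂ := blockLength_le_rpow (show 0 < x by omega)
  calc ((((Computability.encodeNat x).length + 1) * (programCost (width x) x + 1) : ℕ) : ℝ)
      ≤ ((2 ^ 60 * (((Computability.encodeNat x).length + 1) ^ 3 * blockLength x ^ 31) : ℕ) : ℝ) :=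
        Nat.cast_le.2 (programCost_width_le hx)
    _ = 2 ^ 60 * (((Computability.encodeNat x).length + 1 : ℝ) ^ 3 * (blockLength x : ℝ) ^ 31) := by
        push_cast; ring
    _ ≤ 2 ^ 60 * ((2000 * (x : ℝ) ^ ((1 : ℝ) / 384)) ^ 3 * ((x : ℝ) ^ ((1 : ℝ) / 64)) ^ 31) := by
        gcongr
    _ = 2 ^ 60 * 2000 ^ 3 *
          (((x : ℝ) ^ ((1 : ℝ) / 384)) ^ 3 * ((x : ℝ) ^ ((1 : ℝ) / 64)) ^ 31) := by
        ring
    _ = 2 ^ 60 * 2000 ^ 3 * (x : ℝ) ^ ((1 : ℝ) / 2 - 1 / 128) := by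
        rw [← Real.rpow_mul_natCast hx0.le, ← Real.rpow_mul_natCast hx0.le, ← Real.rpow_add hx0]
        norm_num

end DivisorSummatory

theorem theorem2p1 :
    ∃ c₀ : ℝ, 0 < c₀ ∧ ∃ (T : ℕ → ℕ) (ε : ℕ → ℝ),
      Filter.Tendsto ε Filter.atTop (nhds 0) ∧
      (fun x : ℕ => (T x : ℝ)) =O[Filter.atTop]
        (fun x : ℕ => (x : ℝ) ^ ((1 : ℝ) / 2 - c₀ + ε x)) ∧
      ComputableInTimeAtMost divisorSum T := by
  obtain ⟨C, hC⟩ := DivisorSummatory.exists_divisorSum_computableInTimeAtMost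
  refine ⟨1 / 128, by norm_num, _, fun _ => 0, tendsto_const_nhds, ?_, hC⟩
  simpa only [add_zero] using DivisorSummatory.isBigO_programCost C
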